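/- Call a set $\Omega\subset\mathbb R^2$ regular if it is bounded and open with boundary of class $C^\infty$ (near each boundary point, in suitable Cartesian coordinates, $\Omega$ is the strict subgraph of a smooth function). Let $P(\Omega)=\sup\{\int_\Omega \operatorname{div}T\,dx : T\in C_c^1(\mathbb R^2;\mathbb R^2),\ |T|\le 1\}$ be the perimeter, let $\kappa$ be the curvature of $\partial\Omega$, and for $\lambda,\alpha>0$ set $$F_{\lambda,\alpha}(\Omega)=P(\Omega)-\frac{\lambda^2}{4\pi}\int_\Omega\int_{\Omega^c}\frac{e^{-\lambda\alpha|x-y|}}{|x-y|}\,dy\,dx .$$ Let $\alpha>0$ and let $\Omega$ be a regular set. Then $P(\Omega)$, the double integral (for every $\lambda>0$) and $\int_{\partial\Omega}\kappa^2\,d\mathcal H^1$ are finite, and, as $\lambda\to\infty$, $$F_{\lambda,\alpha}(\Omega)=\Big(1-\frac{1}{2\pi\alpha^2}\Big)P(\Omega)+\frac{1}{8\pi\alpha^4\lambda^2}\int_{\partial\Omega}\kappa^2\,d\mathcal H^1+o(\lambda^{-2}).$$ -/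

import Mathlib

open MeasureTheory Filter Topology Asymptotics
open scoped ContDiff ENNReal

noncomputable section

/-- The Euclidean plane. -/
abbrev Plane : Type := EuclideanSpace ℝ (Fin 2)

/-- A regular set: a bounded open set with boundary of class `C^∞`, i.e. near each boundary point,
in suitable Cartesian coordinates, the set is the strict subgraph of a smooth function (in
particular it lies on one side of its boundary). -/
structure IsRegularSet (Ω : Set Plane) : Prop where
  isOpen : IsOpen Ω
  isBounded : Bornology.IsBounded Ω
  smooth_boundary : ∀ x ∈ frontier Ω, ∃ r : ℝ, 0 < r ∧ ∃ (e : Plane ≃ₗᵢ[ℝ] Plane) (f : ℝ → ℝ),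
    ContDiff ℝ ∞ f ∧
      ∀ y ∈ Metric.ball x r, (y ∈ Ω ↔ (e y) 1 < f ((e y) 0))

/-- The divergence of a vector field on the plane. -/
def planeDiv (T : Plane → Plane) (x : Plane) : ℝ :=
  ∑ i : Fin 2, (fderiv ℝ T x (EuclideanSpace.single i 1)) i

/-- The (De Giorgi) perimeter of a subset of the plane:
the supremum of `∫_Ω div T` over all `T ∈ C_c^1(ℝ², ℝ²)` with `|T| ≤ 1`. -/
def perimeter (Ω : Set Plane) : ℝ≥0∞ :=
  ⨆ (T : Plane → Plane) (_ : ContDiff ℝ 1 T ∧ HasCompactSupport T ∧ ∀ x, ‖T x‖ ≤ 1),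
    ENNReal.ofReal (∫ x in Ω, planeDiv T x)

/-- The screened kernel `e^{-a|z|} / |z|`. -/
def yukawa (a : ℝ) (z : Plane) : ℝ := Real.exp (-(a * ‖z‖)) / ‖z‖

/-- The energy `F_{λ,α}(Ω)`, with `l` in the role of `λ`. -/
def energy (l α : ℝ) (Ω : Set Plane) : ℝ :=
  (perimeter Ω).toReal -
    l ^ 2 / (4 * Real.pi) * ∫ x in Ω, ∫ y in Ωᶜ, yukawa (l * α) (x - y)

/-- Counterclockwise rotation by a right angle, `(v₁, v₂)^⊥ = (-v₂, v₁)`. -/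
def perp (v : Plane) : Plane := !₂[-v 1, v 0]

/-- `k` is the (signed) curvature of `∂Ω` at `x`: it is `(γ')^⊥ · γ'' / |γ'|³` at `t = 0` for some
regular curve `γ` running in `∂Ω`, with `γ 0 = x`, oriented so that `-(γ')^⊥` points
out of `Ω` (so `k > 0` for a disk). -/
def HasBoundaryCurvature (Ω : Set Plane) (x : Plane) (k : ℝ) : Prop :=
  ∃ γ : ℝ → Plane, ContDiffAt ℝ 2 γ 0 ∧ γ 0 = x ∧ deriv γ 0 ≠ 0 ∧
    (∀ᶠ t in 𝓝 (0 : ℝ), γ t ∈ frontier Ω) ∧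
    (∀ᶠ s in 𝓝[>] (0 : ℝ), x + s • perp (deriv γ 0) ∈ Ω) ∧
    k = inner ℝ (perp (deriv γ 0)) (deriv (deriv γ) 0) / ‖deriv γ 0‖ ^ 3

open Classical in
/-- The curvature `κ` of `∂Ω`. At every boundary point of a regular set there is exactly one `k`
with `HasBoundaryCurvature Ω x k`; where there is none the value is `0`. -/
def curvature (Ω : Set Plane) (x : Plane) : ℝ :=
  if h : ∃ k, HasBoundaryCurvature Ω x k then h.choose else 0

end

/-! Put `a = λα`. Away from the origin the radial field `X(z) = e^{-a|z|} z / (a|z|²)` has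
divergence `-e^{-a|z|}/|z|`. For `x ∈ Ω`, the divergence theorem therefore turns the inner integral
over `Ωᶜ` into a flux of `X(· - x)` through `∂Ω` (`IsRegularSet.integral_compl_yukawa`). After
Fubini, each boundary point `y` contributes an integral over `Ω` of `fluxKernel a (n y) (x - y)`. If
`Ω` were the half-plane behind the tangent line at `y`, this would equal exactly `2/a²`, which
produces the perimeter term (`integral_halfPlane_fluxKernel`,
`IsRegularSet.integral_integral_yukawa`).

The correction `fluxDefect` comes from the thin region between `∂Ω` and its tangent line. In
tangent-normal coordinates `(u/a, v/a²)` that region converges to the one between `v = 0` and `v = c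
u²/2`, with `c² = κ²`, and the kernel becomes `-v/u² · e^{-|u|}`. Integrating in `v` gives `c² u²
e^{-|u|}/8`, and then in `u` gives `c²/2`. Hence `a⁴ · fluxDefect → κ²/2`
(`tendsto_pow_four_mul_fluxDefect`). Only the square of the curvature enters, so orientation plays
no role.

Dominated convergence, in the plane and then along `∂Ω`, rests on one geometric fact: `Ω` lies
between two tangent parabolas at every boundary point, with a uniform constant
(`IsRegularSet.exists_uniform_isParabolicTangent`). The divergence theorem and the identity of
perimeter with boundary length follow from graph charts, an area formula for curves and a partition
of unity. -/

/-! ### Cartesian frames and the divergence. -/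

/-- The linear coordinates `(s, t) ↦ e⁻¹ (s, t)` on the plane attached to a linear isometry. -/
noncomputable def planeCoord (e : Plane ≃ₗᵢ[ℝ] Plane) : (ℝ × ℝ) ≃L[ℝ] Plane :=
  LinearEquiv.toContinuousLinearEquiv
    { toFun := fun p => e.symm !₂[p.1, p.2]
      invFun := fun x => ((e x) 0, (e x) 1)
      map_add' := fun p q => by
        rw [← map_add]; congr 1; ext i; fin_cases i <;> simp
      map_smul' := fun c p => by
        rw [RingHom.id_apply, ← map_smul]; congr 1; ext i; fin_cases i <;> simp
      left_inv := fun p => by simp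
      right_inv := fun x => by
        rw [LinearIsometryEquiv.symm_apply_eq]; ext i; fin_cases i <;> simp }

theorem planeCoord_apply (e : Plane ≃ₗᵢ[ℝ] Plane) (p : ℝ × ℝ) :
    planeCoord e p = e.symm !₂[p.1, p.2] := rfl

@[simp] theorem apply_planeCoord_zero (e : Plane ≃ₗᵢ[ℝ] Plane) (p : ℝ × ℝ) :
    (e (planeCoord e p)) 0 = p.1 := by simp [planeCoord_apply]

@[simp] theorem apply_planeCoord_one (e : Plane ≃ₗᵢ[ℝ] Plane) (p : ℝ × ℝ) :
    (e (planeCoord e p)) 1 = p.2 := by simp [planeCoord_apply]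

theorem norm_planeCoord (e : Plane ≃ₗᵢ[ℝ] Plane) (p : ℝ × ℝ) :
    ‖planeCoord e p‖ = √(p.1 ^ 2 + p.2 ^ 2) := by
  simp [planeCoord_apply, EuclideanSpace.norm_eq]

theorem measurePreserving_planeCoord (e : Plane ≃ₗᵢ[ℝ] Plane) :
    MeasurePreserving (planeCoord e) := by
  have h1 := (volume_preserving_finTwoArrow ℝ).symm
  have h2 := (PiLp.volume_preserving_toLp (Fin 2))
  have h3 := e.symm.measurePreserving
  have heq : ⇑(planeCoord e) = e.symm ∘ WithLp.toLp 2 ∘ (MeasurableEquiv.finTwoArrow (α := ℝ)).symm := by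
    funext p
    rw [planeCoord_apply, Function.comp_apply, Function.comp_apply]
    congr 1
  rw [heq]
  exact h3.comp (h2.comp h1)

theorem measurableEmbedding_planeCoord (e : Plane ≃ₗᵢ[ℝ] Plane) :
    MeasurableEmbedding (planeCoord e) :=
  (planeCoord e).toHomeomorph.measurableEmbedding

theorem inner_plane (x y : Plane) : inner ℝ x y = x 0 * y 0 + x 1 * y 1 := by
  simp [PiLp.inner_apply, Fin.sum_univ_two]; ring

/-- Every unit vector is the second vector of a Cartesian frame. -/
theorem exists_isometry_apply_one_eq_inner (n : Plane) (hn : ‖n‖ = 1) :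
    ∃ e : Plane ≃ₗᵢ[ℝ] Plane, ∀ z, (e z) 1 = inner ℝ n z := by
  set w : Plane := EuclideanSpace.single 1 1
  have hw : ‖w‖ = 1 := by simp [w]
  -- The reflection across the line orthogonal to `n - w` exchanges the unit vectors `n` and `w`.
  refine ⟨(ℝ ∙ (n - w))ᗮ.reflection, fun z => ?_⟩
  have h1 : (ℝ ∙ (n - w))ᗮ.reflection n = w := Submodule.reflection_sub (hn.trans hw.symm)
  rw [← LinearIsometryEquiv.inner_map_map ((ℝ ∙ (n - w))ᗮ.reflection) n z, h1, inner_plane]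
  simp [w]

/-- The trace does not depend on the basis, which is what allows the divergence to be computed in
any Cartesian frame. -/
theorem planeDiv_eq_trace (T : Plane → Plane) (x : Plane) :
    planeDiv T x = LinearMap.trace ℝ Plane (fderiv ℝ T x : Plane →ₗ[ℝ] Plane) := by
  rw [LinearMap.trace_eq_sum_inner _ (EuclideanSpace.basisFun (Fin 2) ℝ)]
  simp [planeDiv, inner_plane]

theorem planeDiv_eq_isometry (e : Plane ≃ₗᵢ[ℝ] Plane) (T : Plane → Plane) (x : Plane) :
    planeDiv T x = (e (fderiv ℝ T x (planeCoord e (1, 0)))) 0 +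
      (e (fderiv ℝ T x (planeCoord e (0, 1)))) 1 := by
  rw [planeDiv_eq_trace, LinearMap.trace_eq_sum_inner _
    ((EuclideanSpace.basisFun (Fin 2) ℝ).map e.symm), Fin.sum_univ_two]
  have h0 : (EuclideanSpace.single 0 1 : Plane) = !₂[1, 0] := by ext i; fin_cases i <;> simp
  have h1 : (EuclideanSpace.single 1 1 : Plane) = !₂[0, 1] := by ext i; fin_cases i <;> simp
  simp only [OrthonormalBasis.map_apply, EuclideanSpace.basisFun_apply, h0, h1, planeCoord_apply]
  rw [← LinearIsometryEquiv.inner_map_map e, ← LinearIsometryEquiv.inner_map_map e (e.symm !₂[0, 1])]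
  simp [inner_plane]

theorem finrank_plane : Module.finrank ℝ Plane = 2 := by simp

/-! ### The screened kernel and its flux across a half-plane. -/

theorem yukawa_neg (a : ℝ) (z : Plane) : yukawa a (-z) = yukawa a z := by simp [yukawa]

/-- In polar coordinates the Jacobian `r` cancels the singularity `1/r`, leaving a decaying
exponential. -/
theorem integrable_yukawa {a : ℝ} (ha : 0 < a) : Integrable (yukawa a) := by
  have h := integrable_fun_norm_addHaar (volume : Measure Plane)
    (f := fun r : ℝ => Real.exp (-(a * r)) / r)
  refine h.2 ?_
  have h2 : IntegrableOn (fun r : ℝ => Real.exp (-a * r)) (Set.Ioi 0) := integrableOn_exp_mul_Ioi (by linarith) 0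
  refine h2.congr_fun (fun r hr => ?_) measurableSet_Ioi
  have : r ≠ 0 := (ne_of_gt hr)
  simp only [finrank_plane, smul_eq_mul]
  field_simp
  simp

/-- The flux kernel: minus the radial field whose divergence is `-yukawa a`, paired with `n`. -/
noncomputable def fluxKernel (a : ℝ) (n z : Plane) : ℝ :=
  -(inner ℝ n z) / ‖z‖ ^ 2 * Real.exp (-(a * ‖z‖)) / a

theorem abs_fluxKernel_le {a : ℝ} (ha : 0 < a) (n z : Plane) (hn : ‖n‖ ≤ 1) :
    |fluxKernel a n z| ≤ yukawa a z / a := by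
  have h := abs_real_inner_le_norm n z
  unfold fluxKernel yukawa
  rw [abs_div, abs_mul, abs_div, abs_neg, abs_of_pos ha, Real.abs_exp, abs_of_nonneg (sq_nonneg ‖z‖)]
  gcongr
  rcases eq_or_ne z 0 with rfl | hz
  · simp
  have hz' : 0 < ‖z‖ := norm_pos_iff.2 hz
  rw [div_mul_eq_mul_div, div_le_div_iff₀ (by positivity) hz']
  have : |inner ℝ n z| ≤ ‖z‖ := h.trans (by nlinarith)
  have := mul_le_mul_of_nonneg_right this (mul_nonneg (Real.exp_nonneg (-(a * ‖z‖))) hz'.le)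
  nlinarith

theorem measurable_fluxKernel (a : ℝ) : Measurable (fun p : Plane × Plane => fluxKernel a p.1 p.2) := by
  unfold fluxKernel
  fun_prop

theorem integrable_fluxKernel {a : ℝ} (ha : 0 < a) (n : Plane) (hn : ‖n‖ ≤ 1) :
    Integrable (fluxKernel a n) := by
  refine ((integrable_yukawa ha).div_const a).mono'
    ((measurable_fluxKernel a).comp (measurable_const.prodMk measurable_id)).aestronglyMeasurable ?_
  exact Eventually.of_forall fun z => abs_fluxKernel_le ha n z hn

/-- In polar coordinates adapted to `n` the integrand, Jacobian included, is `e^{-ar}/a · (-sin θ)`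
on `-π < θ < 0`: the radial factor integrates to `1/a²` and the angular one to `2`. -/
theorem integral_halfPlane_fluxKernel {a : ℝ} (ha : 0 < a) (n : Plane) (hn : ‖n‖ = 1) :
    ∫ z in {z | inner ℝ n z < 0}, fluxKernel a n z = 2 / a ^ 2 := by
  obtain ⟨e, he⟩ := exists_isometry_apply_one_eq_inner n hn
  have hm : MeasurableSet {z : Plane | inner ℝ n z < 0} :=
    measurableSet_lt (by fun_prop) measurable_const
  rw [← integral_indicator hm, ← (measurePreserving_planeCoord e).integral_comp
    (measurableEmbedding_planeCoord e), ← integral_comp_polarCoord_symm]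
  have hcalc : ∀ p ∈ polarCoord.target, p.1 • Set.indicator {z : Plane | inner ℝ n z < 0}
      (fluxKernel a n) (planeCoord e (polarCoord.symm p)) =
      (Real.exp (-a * p.1) / a) * Set.indicator (Set.Iio 0) (fun θ => -Real.sin θ) p.2 := by
    rintro ⟨r, θ⟩ ⟨hr, h1, h2⟩
    simp only [Set.mem_Ioi] at hr h1 h2
    have hsin : inner ℝ n (planeCoord e (polarCoord.symm (r, θ))) = r * Real.sin θ := by
      rw [← he]; simp
    have hnorm : ‖planeCoord e (polarCoord.symm (r, θ))‖ = r := by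
      rw [norm_planeCoord]
      simp only [polarCoord_symm_apply, mul_pow, ← mul_add, Real.cos_sq_add_sin_sq, mul_one]
      exact Real.sqrt_sq hr.le
    have hiff : r * Real.sin θ < 0 ↔ θ < 0 := by
      constructor
      · intro h
        by_contra h0
        have := Real.sin_nonneg_of_nonneg_of_le_pi (not_lt.1 h0) h2.le
        nlinarith
      · intro h
        have := Real.sin_neg_of_neg_of_neg_pi_lt h h1
        nlinarith
    simp only [Set.indicator_apply, Set.mem_ofPred_eq, hsin, hiff, Set.mem_Iio, smul_eq_mul]
    split_ifs
    · rw [fluxKernel, hnorm, hsin]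
      field_simp
    · simp
  rw [setIntegral_congr_fun polarCoord.open_target.measurableSet hcalc, polarCoord_target,
    Measure.volume_eq_prod, setIntegral_prod_mul (fun r => Real.exp (-a * r) / a)
      (Set.indicator (Set.Iio 0) fun θ => -Real.sin θ), integral_div, integral_exp_mul_Ioi (by linarith),
    setIntegral_indicator measurableSet_Iio]
  have : Set.Ioo (-Real.pi) Real.pi ∩ Set.Iio 0 = Set.Ioo (-Real.pi) 0 := by
    ext x; simp only [Set.mem_inter_iff, Set.mem_Ioo, Set.mem_Iio]
    have := Real.pi_pos
    constructor
    · rintro ⟨⟨_, _⟩, _⟩; constructor <;> linarith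
    · rintro ⟨_, _⟩; refine ⟨⟨?_, ?_⟩, ?_⟩ <;> linarith
  rw [this, ← integral_Ioc_eq_integral_Ioo, ← intervalIntegral.integral_of_le (by linarith [Real.pi_pos]),
    intervalIntegral.integral_neg, integral_sin]
  simp
  field_simp
  ring

/-! ### Graph charts and their normals. -/

/-- In the open set `U`, the set `Ω` is the strict subgraph of the smooth function `f` in the
Cartesian coordinates `e`. -/
structure IsGraphChart (Ω U : Set Plane) (e : Plane ≃ₗᵢ[ℝ] Plane) (f : ℝ → ℝ) : Prop where
  isOpen : IsOpen U
  contDiff : ContDiff ℝ ∞ f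
  mem_iff : ∀ y ∈ U, (y ∈ Ω ↔ (e y) 1 < f ((e y) 0))

/-- The length element `√(1 + f'²)` of a graph. -/
noncomputable def graphSpeed (f : ℝ → ℝ) (s : ℝ) : ℝ := √(1 + deriv f s ^ 2)

theorem graphSpeed_pos (f : ℝ → ℝ) (s : ℝ) : 0 < graphSpeed f s :=
  Real.sqrt_pos.2 (by positivity)

theorem one_le_graphSpeed (f : ℝ → ℝ) (s : ℝ) : 1 ≤ graphSpeed f s :=
  Real.one_le_sqrt.2 (by nlinarith [sq_nonneg (deriv f s)])

theorem graphSpeed_sq (f : ℝ → ℝ) (s : ℝ) : graphSpeed f s ^ 2 = 1 + deriv f s ^ 2 :=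
  Real.sq_sqrt (by positivity)

/-- The upward unit normal of the graph of `f`, extended constantly in the vertical direction. -/
noncomputable def chartNormal (e : Plane ≃ₗᵢ[ℝ] Plane) (f : ℝ → ℝ) (y : Plane) : Plane :=
  planeCoord e (-deriv f ((e y) 0) / graphSpeed f ((e y) 0), 1 / graphSpeed f ((e y) 0))

theorem norm_chartNormal (e : Plane ≃ₗᵢ[ℝ] Plane) (f : ℝ → ℝ) (y : Plane) :
    ‖chartNormal e f y‖ = 1 := by
  have h := graphSpeed_sq f ((e y) 0)
  have h0 := graphSpeed_pos f ((e y) 0)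
  rw [chartNormal, norm_planeCoord, Real.sqrt_eq_one]
  field_simp
  linarith

theorem inner_planeCoord (e : Plane ≃ₗᵢ[ℝ] Plane) (p : ℝ × ℝ) (z : Plane) :
    inner ℝ (planeCoord e p) z = p.1 * (e z) 0 + p.2 * (e z) 1 := by
  rw [← LinearIsometryEquiv.inner_map_map e, inner_plane]; simp

theorem graphSpeed_mul_inner_chartNormal (e : Plane ≃ₗᵢ[ℝ] Plane) (f : ℝ → ℝ) (y z : Plane) :
    graphSpeed f ((e y) 0) * inner ℝ (chartNormal e f y) z =
      (e z) 1 - deriv f ((e y) 0) * (e z) 0 := by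
  have h0 := graphSpeed_pos f ((e y) 0)
  rw [chartNormal, inner_planeCoord]
  field_simp
  ring

theorem contDiff_graphSpeed {f : ℝ → ℝ} (hf : ContDiff ℝ ∞ f) : ContDiff ℝ ∞ (graphSpeed f) := by
  have hd : ContDiff ℝ ∞ (deriv f) := hf.iterate_deriv 1
  unfold graphSpeed
  exact ContDiff.sqrt (contDiff_const.add (hd.pow 2)) fun s => by positivity

theorem contDiff_coord (e : Plane ≃ₗᵢ[ℝ] Plane) (i : Fin 2) {n : WithTop ℕ∞} :
    ContDiff ℝ n fun y => (e y) i :=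
  (contDiff_piLp_apply (p := 2) (i := i)).comp e.contDiff

theorem contDiff_chartNormal (e : Plane ≃ₗᵢ[ℝ] Plane) {f : ℝ → ℝ} (hf : ContDiff ℝ ∞ f) :
    ContDiff ℝ ∞ (chartNormal e f) := by
  have hd : ContDiff ℝ ∞ (deriv f) := hf.iterate_deriv 1
  have hN := contDiff_graphSpeed hf
  have hc := contDiff_coord e 0 (n := ∞)
  unfold chartNormal
  refine (planeCoord e).contDiff.comp (ContDiff.prodMk ?_ ?_)
  · exact (hd.comp hc).neg.div (hN.comp hc) fun y => (graphSpeed_pos f _).ne'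
  · exact contDiff_const.div (hN.comp hc) fun y => (graphSpeed_pos f _).ne'

namespace IsGraphChart

variable {Ω U : Set Plane} {e : Plane ≃ₗᵢ[ℝ] Plane} {f : ℝ → ℝ}

theorem mem_frontier_iff (h : IsGraphChart Ω U e f) (hΩ : IsOpen Ω) {y : Plane} (hy : y ∈ U) :
    y ∈ frontier Ω ↔ (e y) 1 = f ((e y) 0) := by
  rw [hΩ.frontier_eq, Set.mem_sdiff, h.mem_iff y hy, not_lt]
  have hc0 : Continuous fun y => (e y) 0 := (contDiff_coord e 0 (n := 0)).continuous
  have hc1 : Continuous fun y => (e y) 1 := (contDiff_coord e 1 (n := 0)).continuous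
  have hfc := h.contDiff.continuous
  constructor
  · rintro ⟨hcl, hle⟩
    refine le_antisymm (not_lt.1 fun hlt => ?_) hle
    obtain ⟨z, ⟨hzU, hz⟩, hzΩ⟩ := mem_closure_iff.1 hcl (U ∩ {z | f ((e z) 0) < (e z) 1})
      (h.isOpen.inter (isOpen_lt (hfc.comp hc0) hc1)) ⟨hy, hlt⟩
    exact lt_asymm hz ((h.mem_iff z hzU).1 hzΩ)
  · intro heq
    refine ⟨?_, heq.ge⟩
    have hlim : Tendsto (fun t : ℝ => y + planeCoord e (0, -t)) (𝓝[>] 0) (𝓝 y) := by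
      have : Continuous fun t : ℝ => y + planeCoord e (0, -t) := by fun_prop
      have := this.tendsto 0
      rw [neg_zero, show ((0 : ℝ), (0 : ℝ)) = 0 from rfl, map_zero, add_zero] at this
      exact this.mono_left nhdsWithin_le_nhds
    refine mem_closure_of_tendsto hlim ?_
    filter_upwards [hlim (h.isOpen.mem_nhds hy), self_mem_nhdsWithin] with t ht ht0
    refine (h.mem_iff _ ht).2 ?_
    simp only [map_add, PiLp.add_apply, apply_planeCoord_zero, apply_planeCoord_one, add_zero, heq]
    have : 0 < t := ht0
    linarith

/-- Membership becomes a comparison of the normal displacement with the first-order Taylor remainder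
of `f`. Both the parabolic bounds and the parabolic blow-up are read off from this form. -/
theorem add_mem_iff (h : IsGraphChart Ω U e f) (hΩ : IsOpen Ω) {y z : Plane} (hy : y ∈ U)
    (hyΩ : y ∈ frontier Ω) (hz : y + z ∈ U) :
    y + z ∈ Ω ↔ graphSpeed f ((e y) 0) * inner ℝ (chartNormal e f y) z <
      f ((e y) 0 + (e z) 0) - f ((e y) 0) - deriv f ((e y) 0) * (e z) 0 := by
  rw [h.mem_iff _ hz, graphSpeed_mul_inner_chartNormal, map_add, PiLp.add_apply, PiLp.add_apply,
    (h.mem_frontier_iff hΩ hy).1 hyΩ]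
  constructor <;> intro h <;> linarith

end IsGraphChart

/-! ### Tangent parabolas and independence of the normal from the chart. -/

/-- The mean value inequality is applied twice, with `C` bounding `f''` on the ball of radius 2,
which contains every `s + h`. -/
theorem exists_quadratic_bound {f : ℝ → ℝ} (hf : ContDiff ℝ 2 f) (s₀ : ℝ) :
    ∃ C : ℝ, 0 ≤ C ∧ ∀ s ∈ Metric.closedBall s₀ 1, ∀ h : ℝ, |h| ≤ 1 →
      |f (s + h) - f s - deriv f s * h| ≤ C * h ^ 2 := by
  have hd : ContDiff ℝ 1 (deriv f) := ((contDiff_succ_iff_deriv (n := 1)).1 hf).2.2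
  have hdd : Continuous (deriv (deriv f)) := hd.continuous_deriv le_rfl
  obtain ⟨C, hC⟩ := (isCompact_closedBall s₀ 2).exists_bound_of_continuousOn hdd.continuousOn
  have hC0 : 0 ≤ C := (norm_nonneg _).trans (hC s₀ (by simp))
  refine ⟨C, hC0, fun s hs h hh => ?_⟩
  have hsub : ∀ k ∈ Set.uIcc 0 h, s + k ∈ Metric.closedBall s₀ 2 := by
    intro k hk
    have hk' : |k| ≤ |h| := by simpa using Set.abs_sub_left_of_mem_uIcc hk
    rw [Metric.mem_closedBall, Real.dist_eq] at hs ⊢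
    calc |s + k - s₀| = |(s - s₀) + k| := by ring_nf
      _ ≤ |s - s₀| + |k| := abs_add_le _ _
      _ ≤ 2 := by linarith
  have h1 : ∀ k ∈ Set.uIcc 0 h, ‖deriv f (s + k) - deriv f s‖ ≤ C * |h| := by
    intro k hk
    have hk' : |k| ≤ |h| := by simpa using Set.abs_sub_left_of_mem_uIcc hk
    have := (convex_closedBall s₀ 2).norm_image_sub_le_of_norm_deriv_le (f := deriv f) (C := C)
      (fun x _ => hd.differentiable one_ne_zero x) hC
      (hsub 0 Set.left_mem_uIcc) (hsub k hk)
    refine (by simpa using this : _ ≤ C * |k|).trans (by gcongr)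
  have h2 := (convex_uIcc (0 : ℝ) h).norm_image_sub_le_of_norm_hasDerivWithin_le
    (f := fun k => f (s + k) - deriv f s * k) (f' := fun k => deriv f (s + k) - deriv f s)
    (C := C * |h|) (fun k _ => by
      have hfk : HasDerivAt f (deriv f (s + k)) (s + k) :=
        (hf.differentiable two_ne_zero _).hasDerivAt
      have := (hfk.comp_const_add s k).fun_sub ((hasDerivAt_id' k).const_mul (deriv f s))
      rw [mul_one] at this
      exact this.hasDerivWithinAt) h1 Set.left_mem_uIcc Set.right_mem_uIcc
  simp only [add_zero, mul_zero, sub_zero, Real.norm_eq_abs] at h2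
  calc _ = |f (s + h) - deriv f s * h - f s| := by ring_nf
    _ ≤ _ := h2
    _ = C * h ^ 2 := by rw [mul_assoc, ← sq, sq_abs]

/-- `Ω` lies between two parabolas tangent at `y` to the line orthogonal to `n`. -/
def IsParabolicTangent (Ω : Set Plane) (y n : Plane) (C : ℝ) : Prop :=
  ∀ z, (inner ℝ n z < -(C * ‖z‖ ^ 2) → y + z ∈ Ω) ∧ (C * ‖z‖ ^ 2 < inner ℝ n z → y + z ∉ Ω)

theorem IsParabolicTangent.mono {Ω : Set Plane} {y n : Plane} {C D : ℝ}
    (h : IsParabolicTangent Ω y n C) (hCD : C ≤ D) : IsParabolicTangent Ω y n D := by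
  intro z
  have : C * ‖z‖ ^ 2 ≤ D * ‖z‖ ^ 2 := by gcongr
  exact ⟨fun hz => (h z).1 (by linarith), fun hz => (h z).2 (by linarith)⟩

/-- If `n ≠ m`, the vector `v = m - n` points strictly inward for `n` and strictly outward for `m`.
A small multiple of `v` beats both quadratic errors, so it would lead both into and out of `Ω`. -/
theorem IsParabolicTangent.normal_unique {Ω : Set Plane} {y n m : Plane} {C D : ℝ}
    (hn : IsParabolicTangent Ω y n C) (hm : IsParabolicTangent Ω y m D)
    (hn1 : ‖n‖ = 1) (hm1 : ‖m‖ = 1) : n = m := by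
  by_contra hne
  have hlt : inner ℝ n m < 1 := (inner_lt_one_iff_real_of_norm_eq_one hn1 hm1).2 hne
  set v := m - n
  set q := 1 - inner ℝ n m
  have hq : 0 < q := by simp only [q]; linarith
  have hnv : inner ℝ n v = -q := by
    simp only [v, q, inner_sub_right, real_inner_self_eq_norm_sq, hn1]; ring
  have hmv : inner ℝ m v = q := by
    simp only [v, q, inner_sub_right, real_inner_self_eq_norm_sq, hm1, real_inner_comm]; ring
  -- `B` exceeds both `C‖v‖²` and `D‖v‖²`, so for `t = q / B` the quadratic errors `t² C‖v‖²` and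
  -- `t² D‖v‖²` stay below the linear term `t q`.
  set B := (|C| + |D|) * ‖v‖ ^ 2 + 1
  have hB : 0 < B := by positivity
  set t := q / B
  have ht : 0 < t := by positivity
  have htB : t * B = q := by simp only [t]; field_simp
  have h1 : C * ‖v‖ ^ 2 < B := by
    have := mul_le_mul_of_nonneg_right (le_abs_self C) (sq_nonneg ‖v‖)
    have := mul_nonneg (abs_nonneg D) (sq_nonneg ‖v‖)
    simp only [B]; linarith
  have h2 : D * ‖v‖ ^ 2 < B := by
    have := mul_le_mul_of_nonneg_right (le_abs_self D) (sq_nonneg ‖v‖)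
    have := mul_nonneg (abs_nonneg C) (sq_nonneg ‖v‖)
    simp only [B]; linarith
  have hnorm : ‖t • v‖ ^ 2 = t ^ 2 * ‖v‖ ^ 2 := by
    rw [norm_smul, mul_pow, Real.norm_eq_abs, sq_abs]
  refine (hm (t • v)).2 ?_ ((hn (t • v)).1 ?_)
  · rw [inner_smul_right, hmv, hnorm]
    nlinarith [mul_lt_mul_of_pos_left h2 (pow_pos ht 2)]
  · rw [inner_smul_right, hnv, hnorm]
    nlinarith [mul_lt_mul_of_pos_left h1 (pow_pos ht 2)]

theorem abs_coord_le_norm (e : Plane ≃ₗᵢ[ℝ] Plane) (z : Plane) (i : Fin 2) : |(e z) i| ≤ ‖z‖ := by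
  rw [← e.norm_map z]; exact PiLp.norm_apply_le (e z) i

theorem IsGraphChart.exists_isParabolicTangent {Ω U : Set Plane} {e : Plane ≃ₗᵢ[ℝ] Plane}
    {f : ℝ → ℝ} (h : IsGraphChart Ω U e f) (hΩ : IsOpen Ω) {x : Plane} (hx : x ∈ U) :
    ∃ C : ℝ, ∀ᶠ y in 𝓝 x, y ∈ frontier Ω → IsParabolicTangent Ω y (chartNormal e f y) C := by
  obtain ⟨r, hr, hrU⟩ := Metric.isOpen_iff.1 h.isOpen x hx
  obtain ⟨C, hC0, hC⟩ := exists_quadratic_bound (h.contDiff.of_le (by norm_cast)) ((e x) 0)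
  set δ := min (r / 2) 1
  have hδ : 0 < δ := by positivity
  have hδr : δ ≤ r / 2 := min_le_left _ _
  have hδ1 : δ ≤ 1 := min_le_right _ _
  -- `C` handles `‖z‖ < δ` through Taylor's formula. For `‖z‖ ≥ δ` the summand `1 / δ` makes both
  -- conditions vacuous, since then `|⟨n, z⟩| ≤ ‖z‖ ≤ ‖z‖² / δ`.
  refine ⟨C + 1 / δ, ?_⟩
  filter_upwards [Metric.ball_mem_nhds x hδ] with y hy hyΩ z
  have hyU : y ∈ U := hrU (Metric.ball_subset_ball (by linarith) hy)
  have hn := norm_chartNormal e f y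
  have hin := abs_real_inner_le_norm (chartNormal e f y) z
  rw [hn, one_mul] at hin
  rcases lt_or_ge ‖z‖ δ with hz | hz
  · have hyz : y + z ∈ U := by
      apply hrU
      rw [Metric.mem_ball, dist_eq_norm] at hy ⊢
      calc ‖y + z - x‖ = ‖(y - x) + z‖ := by congr 1; abel
        _ ≤ ‖y - x‖ + ‖z‖ := norm_add_le _ _
        _ < r := by linarith
    have hsy : (e y) 0 ∈ Metric.closedBall ((e x) 0) 1 := by
      rw [Metric.mem_closedBall, Real.dist_eq]
      have := abs_coord_le_norm e (y - x) 0
      rw [map_sub, PiLp.sub_apply] at this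
      rw [Metric.mem_ball, dist_eq_norm] at hy
      linarith
    have hez := abs_coord_le_norm e z 0
    have hq := abs_le.1 (hC _ hsy ((e z) 0) (by linarith))
    have hsq : ((e z) 0) ^ 2 ≤ ‖z‖ ^ 2 := sq_le_sq' (by linarith [neg_abs_le ((e z) 0)])
      ((le_abs_self _).trans hez)
    have hCz : C * ((e z) 0) ^ 2 ≤ C * ‖z‖ ^ 2 := by gcongr
    have hpos : 0 ≤ 1 / δ * ‖z‖ ^ 2 := by positivity
    have hN := one_le_graphSpeed f ((e y) 0)
    rw [h.add_mem_iff hΩ hyU hyΩ hyz]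
    have hCn : 0 ≤ C * ‖z‖ ^ 2 := by positivity
    constructor
    · intro hlt
      nlinarith
    · intro hlt
      rw [not_lt]
      nlinarith
  · have hle : ‖z‖ ≤ (C + 1 / δ) * ‖z‖ ^ 2 := by
      have : ‖z‖ ≤ 1 / δ * ‖z‖ ^ 2 := by
        rw [one_div, inv_mul_eq_div, le_div_iff₀ hδ]; nlinarith
      have hCn : 0 ≤ C * ‖z‖ ^ 2 := by positivity
      linarith
    have := abs_le.1 hin
    exact ⟨fun hlt => by linarith, fun hlt => by linarith⟩

theorem IsRegularSet.exists_isGraphChart {Ω : Set Plane} (hΩ : IsRegularSet Ω) {x : Plane}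
    (hx : x ∈ frontier Ω) : ∃ (r : ℝ) (e : Plane ≃ₗᵢ[ℝ] Plane) (f : ℝ → ℝ), 0 < r ∧
      IsGraphChart Ω (Metric.ball x r) e f := by
  obtain ⟨r, hr, e, f, hf, h⟩ := hΩ.smooth_boundary x hx
  exact ⟨r, e, f, hr, Metric.isOpen_ball, hf, h⟩

/-- Tangent parabolas characterise the normal without reference to coordinates, so two charts must
agree on it. -/
theorem IsGraphChart.chartNormal_eq {Ω U U' : Set Plane} {e e' : Plane ≃ₗᵢ[ℝ] Plane}
    {f f' : ℝ → ℝ} (h : IsGraphChart Ω U e f) (h' : IsGraphChart Ω U' e' f') (hΩ : IsOpen Ω)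
    {y : Plane} (hy : y ∈ U) (hy' : y ∈ U') (hyΩ : y ∈ frontier Ω) :
    chartNormal e f y = chartNormal e' f' y := by
  obtain ⟨C, hC⟩ := h.exists_isParabolicTangent hΩ hy
  obtain ⟨D, hD⟩ := h'.exists_isParabolicTangent hΩ hy'
  exact (hC.self_of_nhds hyΩ).normal_unique (hD.self_of_nhds hyΩ) (norm_chartNormal _ _ _)
    (norm_chartNormal _ _ _)

/-! ### Curvature in a graph chart and parabolic blow-up. -/

theorem taylor_two_isLittleO {f : ℝ → ℝ} (hf : ContDiff ℝ 2 f) (s : ℝ) :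
    (fun h => f (s + h) - f s - deriv f s * h - deriv (deriv f) s / 2 * h ^ 2) =o[𝓝 0]
      fun h => h ^ 2 := by
  have h := taylor_isLittleO_univ (n := 2) (x₀ := s) (by exact_mod_cast hf)
  have hlim : Tendsto (fun h : ℝ => s + h) (𝓝 0) (𝓝 s) := by
    have : Continuous fun h : ℝ => s + h := by fun_prop
    simpa using this.tendsto 0
  refine (h.comp_tendsto hlim).congr (fun h => ?_) (fun h => by simp)
  simp only [Function.comp_apply, taylorWithinEval_succ, taylor_within_zero_eval,
    iteratedDerivWithin_univ, iteratedDeriv_succ, iteratedDeriv_zero]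
  simp
  ring

/-- The right-hand side is invariant under all linear isometries, including those reversing
orientation, so squared curvature may be computed in any chart. -/
theorem sq_inner_perp (v w : Plane) :
    inner ℝ (perp v) w ^ 2 = ‖v‖ ^ 2 * ‖w‖ ^ 2 - inner ℝ v w ^ 2 := by
  simp only [EuclideanSpace.norm_sq_eq, Fin.sum_univ_two, Real.norm_eq_abs, sq_abs, inner_plane, perp]
  simp
  ring

/-- The curvature of the graph of `f`, up to sign. -/
noncomputable def graphCurvature (f : ℝ → ℝ) (s : ℝ) : ℝ := deriv (deriv f) s / graphSpeed f s ^ 3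

namespace IsGraphChart

variable {Ω U : Set Plane} {e : Plane ≃ₗᵢ[ℝ] Plane} {f : ℝ → ℝ}

/-- The Taylor remainder along the rescaled point, multiplied by `a²`, tends to `N c u²/2` with `c`
the graph curvature, while the normal displacement contributes exactly `N v`. Off the limiting
parabola the strict inequality persists for large `a`. -/
theorem eventually_mem_parabolic_scaling (h : IsGraphChart Ω U e f) (hΩ : IsOpen Ω) {y : Plane}
    (hy : y ∈ U) (hyΩ : y ∈ frontier Ω) {e' : Plane ≃ₗᵢ[ℝ] Plane}
    (he' : ∀ z, (e' z) 1 = inner ℝ (chartNormal e f y) z) {u v : ℝ}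
    (hv : v ≠ graphCurvature f ((e y) 0) / 2 * u ^ 2) :
    ∀ᶠ a : ℝ in atTop, (y + planeCoord e' (u / a, v / a ^ 2) ∈ Ω ↔
      v < graphCurvature f ((e y) 0) / 2 * u ^ 2) := by
  set s := (e y) 0
  set N := graphSpeed f s
  have hN : 0 < N := graphSpeed_pos f s
  have hN2 : N ^ 2 = 1 + deriv f s ^ 2 := graphSpeed_sq f s
  have hinv : Tendsto (fun a : ℝ => a⁻¹) atTop (𝓝 0) := tendsto_inv_atTop_zero
  have hp : Tendsto (fun a : ℝ => ((u / a, v / a ^ 2) : ℝ × ℝ)) atTop (𝓝 0) := by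
    have h1 : Tendsto (fun a : ℝ => u * a⁻¹) atTop (𝓝 0) := by simpa using hinv.const_mul u
    have h2 : Tendsto (fun a : ℝ => v * (a⁻¹) ^ 2) atTop (𝓝 0) := by
      simpa using (hinv.pow 2).const_mul v
    refine (h1.prodMk_nhds h2).congr fun a => ?_
    simp [div_eq_mul_inv]
  have hz : Tendsto (fun a : ℝ => planeCoord e' (u / a, v / a ^ 2)) atTop (𝓝 0) := by
    have := ((planeCoord e').continuous.tendsto 0).comp hp
    rwa [map_zero] at this
  have hyz : ∀ᶠ a : ℝ in atTop, y + planeCoord e' (u / a, v / a ^ 2) ∈ U := by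
    have := hz.const_add y
    rw [add_zero] at this
    exact this (h.isOpen.mem_nhds hy)
  set p := (e (planeCoord e' (1, 0))) 0
  set q := (e (planeCoord e' (0, 1))) 0
  have hcoord : ∀ a : ℝ, (e (planeCoord e' (u / a, v / a ^ 2))) 0 = u / a * p + v / a ^ 2 * q := by
    intro a
    have : ((u / a, v / a ^ 2) : ℝ × ℝ) = (u / a) • (1, 0) + (v / a ^ 2) • (0, 1) := by
      ext <;> simp
    rw [this, map_add, map_smul, map_smul, map_add, map_smul, map_smul]
    rfl
  -- `p` is the horizontal component of a unit tangent vector, hence `±1/N`; its sign depends on the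
  -- frame but only `p²` is needed.
  have hp2 : p ^ 2 * N ^ 2 = 1 := by
    have h1 : N * inner ℝ (chartNormal e f y) (planeCoord e' (1, 0)) = 0 := by
      rw [← he']; simp
    rw [graphSpeed_mul_inner_chartNormal] at h1
    have h2 : ‖e (planeCoord e' (1, 0))‖ ^ 2 = 1 := by
      rw [e.norm_map, norm_planeCoord]; simp
    rw [EuclideanSpace.norm_sq_eq, Fin.sum_univ_two, Real.norm_eq_abs, Real.norm_eq_abs, sq_abs,
      sq_abs, sub_eq_zero.1 h1] at h2
    rw [hN2]
    simp only [p, s]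
    linarith
  set H : ℝ → ℝ := fun a => (e (planeCoord e' (u / a, v / a ^ 2))) 0
  have hH0 : Tendsto H atTop (𝓝 0) := by
    have := ((contDiff_coord e 0 (n := 0)).continuous.tendsto 0).comp hz
    rwa [map_zero] at this
  have haH : Tendsto (fun a => a * H a) atTop (𝓝 (u * p)) := by
    have h1 : Tendsto (fun a : ℝ => u * p + v * q * a⁻¹) atTop (𝓝 (u * p)) := by
      simpa using (hinv.const_mul (v * q)).const_add (u * p)
    refine h1.congr' ?_
    filter_upwards [eventually_gt_atTop 0] with a ha
    simp only [H, hcoord]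
    field_simp
  have hT := (taylor_two_isLittleO (h.contDiff.of_le (by norm_cast)) s).comp_tendsto hH0
  have hT2 : Tendsto (fun a => a ^ 2 * (f (s + H a) - f s - deriv f s * H a -
      deriv (deriv f) s / 2 * H a ^ 2)) atTop (𝓝 0) := by
    have h1 : (fun a => a ^ 2 * (f (s + H a) - f s - deriv f s * H a -
      deriv (deriv f) s / 2 * H a ^ 2)) =o[atTop] fun a => a ^ 2 * (H a) ^ 2 :=
      (isBigO_refl (fun a : ℝ => a ^ 2) atTop).mul_isLittleO hT
    have h2 : (fun a => a ^ 2 * (H a) ^ 2) =O[atTop] fun _ => (1 : ℝ) := by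
      have := (haH.pow 2).isBigO_one ℝ
      simpa only [mul_pow] using this
    exact (isLittleO_one_iff ℝ).1 (h1.trans_isBigO h2)
  have hlim : Tendsto (fun a => a ^ 2 * (f (s + H a) - f s - deriv f s * H a)) atTop
      (𝓝 (N * (graphCurvature f s / 2 * u ^ 2))) := by
    have h1 := hT2.add ((haH.pow 2).const_mul (deriv (deriv f) s / 2))
    have h2 : 0 + deriv (deriv f) s / 2 * (u * p) ^ 2 = N * (graphCurvature f s / 2 * u ^ 2) := by
      have : p ^ 2 = 1 / N ^ 2 := by field_simp; exact hp2
      rw [graphCurvature, mul_pow, this, zero_add]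
      simp only [N]
      field_simp
    rw [h2] at h1
    refine h1.congr fun a => ?_
    ring
  have hkey : ∀ᶠ a : ℝ in atTop, (N * v < a ^ 2 * (f (s + H a) - f s - deriv f s * H a) ↔
      v < graphCurvature f s / 2 * u ^ 2) := by
    rcases lt_or_gt_of_ne hv with hlt | hgt
    · filter_upwards [hlim.eventually_const_lt (mul_lt_mul_of_pos_left hlt hN)] with a ha
      exact iff_of_true ha hlt
    · filter_upwards [hlim.eventually_lt_const (mul_lt_mul_of_pos_left hgt hN)] with a ha
      exact iff_of_false (not_lt.2 ha.le) (not_lt.2 hgt.le)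
  filter_upwards [hyz, hkey, eventually_gt_atTop 0] with a ha1 ha2 ha0
  rw [h.add_mem_iff hΩ hy hyΩ ha1, ← ha2, ← he', apply_planeCoord_one]
  change N * (v / a ^ 2) < f (s + H a) - f s - deriv f s * H a ↔ _
  rw [← mul_div_assoc, div_lt_iff₀ (by positivity), mul_comm (a ^ 2)]

/-- In the chart any admissible curve satisfies `γ₁ = f(γ₀)`. Differentiating twice at `0`, the
tangential acceleration cancels and only `f''` and the speed survive. -/
theorem sq_of_hasBoundaryCurvature (h : IsGraphChart Ω U e f) (hΩ : IsOpen Ω) {y : Plane}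
    (hy : y ∈ U) {k : ℝ} (hk : HasBoundaryCurvature Ω y k) :
    k ^ 2 = graphCurvature f ((e y) 0) ^ 2 := by
  obtain ⟨γ, hγ, rfl, hγ0, hfr, -, rfl⟩ := hk
  have hf1 : ∀ t, HasDerivAt f (deriv f t) t := fun t =>
    (h.contDiff.differentiable (by simp) t).hasDerivAt
  have hf2 : ∀ t, HasDerivAt (deriv f) (deriv (deriv f) t) t := fun t =>
    ((h.contDiff.iterate_deriv 1).differentiable (by simp) t).hasDerivAt
  have hγ1 : ∀ᶠ t in 𝓝 0, HasDerivAt γ (deriv γ t) t := by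
    filter_upwards [hγ.eventually (by simp)] with t ht
    exact (ht.differentiableAt (by simp)).hasDerivAt
  have hγ2 : HasDerivAt (deriv γ) (deriv (deriv γ) 0) 0 := by
    have : ContDiffAt ℝ 1 (deriv γ) 0 := by
      have := hγ.fderiv_right (m := 1) (by norm_num)
      exact this.clm_apply contDiffAt_const
    exact (this.differentiableAt (by simp)).hasDerivAt
  have hcomp : ∀ (i : Fin 2) (g : ℝ → Plane) (g' : Plane) (t : ℝ), HasDerivAt g g' t →
      HasDerivAt (fun t => (e (g t)) i) ((e g') i) t := by
    intro i g g' t hg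
    exact ((EuclideanSpace.proj (𝕜 := ℝ) i).comp
      (e.toContinuousLinearEquiv : Plane →L[ℝ] Plane)).hasFDerivAt.comp_hasDerivAt t hg
  have hgraph : ∀ᶠ t in 𝓝 0, (e (γ t)) 1 = f ((e (γ t)) 0) := by
    filter_upwards [hfr, hγ.continuousAt (h.isOpen.mem_nhds hy)] with t ht1 ht2
    exact (h.mem_frontier_iff hΩ ht2).1 ht1
  have hd1 : ∀ᶠ t in 𝓝 0, (e (deriv γ t)) 1 = deriv f ((e (γ t)) 0) * (e (deriv γ t)) 0 := by
    filter_upwards [hgraph.eventually_nhds, hγ1] with t ht1 ht2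
    exact (((hf1 _).comp t (hcomp 0 γ _ t ht2)).congr_of_eventuallyEq ht1).unique
      (hcomp 1 γ _ t ht2) |>.symm
  have hd2 : (e (deriv (deriv γ) 0)) 1 = deriv (deriv f) ((e (γ 0)) 0) * (e (deriv γ 0)) 0 *
      (e (deriv γ 0)) 0 + deriv f ((e (γ 0)) 0) * (e (deriv (deriv γ) 0)) 0 := by
    have := ((hf2 _).comp 0 (hcomp 0 γ _ 0 hγ1.self_of_nhds)).mul (hcomp 0 _ _ 0 hγ2)
    exact (this.congr_of_eventuallyEq hd1).unique (hcomp 1 _ _ 0 hγ2) |>.symm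
  have hd1 := hd1.self_of_nhds
  set s := (e (γ 0)) 0
  have hN := graphSpeed_pos f s
  have hN2 := graphSpeed_sq f s
  rw [div_pow, sq_inner_perp, ← e.inner_map_map, ← e.norm_map (deriv γ 0),
    ← e.norm_map (deriv (deriv γ) 0), ← sq_inner_perp, ← pow_mul, mul_comm 3 2, pow_mul]
  set v := e (deriv γ 0)
  set w := e (deriv (deriv γ) 0)
  have hv0 : v 0 ≠ 0 := by
    intro h0
    refine hγ0 ((map_eq_zero_iff e e.injective).1 ?_)
    ext i
    fin_cases i
    · exact h0
    · simpa [h0] using hd1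
  have hnorm : ‖v‖ ^ 2 = v 0 ^ 2 * graphSpeed f s ^ 2 := by
    rw [hN2, EuclideanSpace.norm_sq_eq, Fin.sum_univ_two, Real.norm_eq_abs, Real.norm_eq_abs, sq_abs,
      sq_abs, hd1]
    ring
  have hin : inner ℝ (perp v) w = v 0 ^ 3 * deriv (deriv f) s := by
    rw [inner_plane, hd2]
    simp only [perp]
    simp [hd1]
    ring
  rw [hnorm, hin, graphCurvature]
  field_simp

theorem exists_hasBoundaryCurvature (h : IsGraphChart Ω U e f) (hΩ : IsOpen Ω) {y : Plane}
    (hy : y ∈ U) (hyΩ : y ∈ frontier Ω) : ∃ k, HasBoundaryCurvature Ω y k := by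
  set s := (e y) 0
  set v := planeCoord e (1, deriv f s)
  set n := chartNormal e f y
  have hn : ‖n‖ = 1 := norm_chartNormal e f y
  have hv : v ≠ 0 := fun h0 => by
    have := congrArg (fun z => (e z) 0) h0
    simp [v] at this
  have hvn : inner ℝ v n = 0 := by
    have h1 := graphSpeed_mul_inner_chartNormal e f y v
    simp only [v, apply_planeCoord_one, apply_planeCoord_zero, mul_one, s, sub_self] at h1
    rw [real_inner_comm]
    exact (mul_eq_zero.1 h1).resolve_left (graphSpeed_pos f _).ne'
  have hperp : inner ℝ (perp v) n ≠ 0 := by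
    have := sq_inner_perp v n
    rw [hvn, hn] at this
    intro h0
    rw [h0] at this
    have : ‖v‖ ^ 2 = 0 := by linarith
    exact hv (by simpa using this)
  -- Reparametrising the graph by the factor `ε = -⟨perp v, n⟩` turns `perp` of the velocity inward,
  -- whatever the orientation of the frame.
  obtain ⟨ε, hε, hneg⟩ : ∃ ε : ℝ, ε ≠ 0 ∧ inner ℝ n (perp (ε • v)) < 0 := by
    refine ⟨-inner ℝ (perp v) n, neg_ne_zero.2 hperp, ?_⟩
    have : perp (-inner ℝ (perp v) n • v) = -inner ℝ (perp v) n • perp v := by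
      ext i; fin_cases i <;> simp [perp]
    rw [this, inner_smul_right, real_inner_comm (perp v) n]
    nlinarith [sq_pos_of_ne_zero hperp]
  set γ : ℝ → Plane := fun t => planeCoord e (s + ε * t, f (s + ε * t))
  have hγ : ContDiff ℝ 2 γ := by
    have hf2 : ContDiff ℝ 2 f := h.contDiff.of_le (by norm_cast)
    have hl : ContDiff ℝ 2 fun t : ℝ => s + ε * t := by fun_prop
    exact (planeCoord e).contDiff.comp (hl.prodMk (hf2.comp hl))
  have hγ0 : γ 0 = y := by
    have h1 := (h.mem_frontier_iff hΩ hy).1 hyΩ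
    simp only [γ, mul_zero, add_zero, s]
    rw [← h1]
    exact (planeCoord e).apply_symm_apply y
  have hγd : deriv γ 0 = ε • v := by
    have hl : HasDerivAt (fun t : ℝ => s + ε * t) ε 0 := by
      simpa using ((hasDerivAt_id (0 : ℝ)).const_mul ε).const_add s
    have hf1 : HasDerivAt f (deriv f s) (s + ε * 0) := by
      rw [mul_zero, add_zero]; exact (h.contDiff.differentiable (by simp) s).hasDerivAt
    have h1 := hl.prodMk (hf1.comp 0 hl)
    have h2 := ((planeCoord e : ℝ × ℝ →L[ℝ] Plane).hasFDerivAt.comp_hasDerivAt (0 : ℝ) h1).deriv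
    refine h2.trans ?_
    simp only [v, ContinuousLinearEquiv.coe_coe, ← map_smul]
    congr 1
    ext <;> simp [mul_comm]
  refine ⟨_, γ, hγ.contDiffAt, hγ0, ?_, ?_, ?_, rfl⟩
  · rw [hγd]; exact smul_ne_zero hε hv
  · have : ∀ᶠ t in 𝓝 (0 : ℝ), γ t ∈ U :=
      hγ.continuous.continuousAt (h.isOpen.mem_nhds (by rwa [hγ0]))
    filter_upwards [this] with t ht
    rw [h.mem_frontier_iff hΩ ht]
    simp [γ]
  · rw [hγd]
    obtain ⟨C, hC⟩ := h.exists_isParabolicTangent hΩ hy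
    have hC := hC.self_of_nhds hyΩ
    set w := perp (ε • v)
    have hlim : Tendsto (fun t : ℝ => -(C * (t * ‖w‖ ^ 2))) (𝓝[>] 0) (𝓝 0) := by
      have : Continuous fun t : ℝ => -(C * (t * ‖w‖ ^ 2)) := by fun_prop
      have := this.tendsto 0
      simp only [zero_mul, mul_zero, neg_zero] at this
      exact this.mono_left nhdsWithin_le_nhds
    filter_upwards [hlim.eventually_const_lt hneg, self_mem_nhdsWithin] with t ht ht0
    have ht0 : 0 < t := ht0
    refine (hC (t • w)).1 ?_
    rw [inner_smul_right, norm_smul, mul_pow, Real.norm_eq_abs, sq_abs]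
    nlinarith [mul_lt_mul_of_pos_left ht ht0]

/-- The choice made in `curvature` is harmless here, because all admissible values have the same
square. -/
theorem curvature_sq (h : IsGraphChart Ω U e f) (hΩ : IsOpen Ω) {y : Plane}
    (hy : y ∈ U) (hyΩ : y ∈ frontier Ω) :
    curvature Ω y ^ 2 = graphCurvature f ((e y) 0) ^ 2 := by
  have hex := h.exists_hasBoundaryCurvature hΩ hy hyΩ
  rw [curvature, dif_pos hex]
  exact h.sq_of_hasBoundaryCurvature hΩ hy hex.choose_spec

end IsGraphChart

/-! ### The area formula for curves. -/

/-- Countably many of the neighbourhoods cover the space; after making them disjoint the local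
inequalities add up. -/
theorem measure_le_const_mul_of_locally {X : Type*} [TopologicalSpace X] [SecondCountableTopology X]
    [MeasurableSpace X] [OpensMeasurableSpace X] [Nonempty X] {μ ν : Measure X} {c : ℝ≥0∞}
    (h : ∀ x, ∃ U ∈ 𝓝 x, ∀ A ⊆ U, MeasurableSet A → μ A ≤ c * ν A) {A : Set X}
    (hA : MeasurableSet A) : μ A ≤ c * ν A := by
  choose U hU hUA using h
  obtain ⟨t, htc, ht⟩ := TopologicalSpace.countable_cover_nhds fun x => interior_mem_nhds.2 (hU x)
  have htne : t.Nonempty := by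
    by_contra hne
    rw [Set.not_nonempty_iff_eq_empty] at hne
    rw [hne, Set.biUnion_empty] at ht
    exact Set.empty_ne_univ ht
  obtain ⟨u, rfl⟩ := htc.exists_eq_range htne
  set V : ℕ → Set X := fun n => interior (U (u n))
  have hV : ∀ n, MeasurableSet (disjointed V n) :=
    MeasurableSet.disjointed fun n => isOpen_interior.measurableSet
  have hunion : ⋃ n, A ∩ disjointed V n = A := by
    rw [← Set.inter_iUnion, iUnion_disjointed]
    have : ⋃ n, V n = Set.univ := by simpa [V] using ht
    rw [this, Set.inter_univ]
  have hdisj : Pairwise (Function.onFun Disjoint fun n => A ∩ disjointed V n) := fun i j hij =>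
    (disjoint_disjointed V hij).mono Set.inter_subset_right Set.inter_subset_right
  rw [← hunion, measure_iUnion hdisj fun n => hA.inter (hV n),
    measure_iUnion hdisj fun n => hA.inter (hV n), ← ENNReal.tsum_mul_left]
  refine ENNReal.tsum_le_tsum fun n => hUA (u n) _ ?_ (hA.inter (hV n))
  exact Set.inter_subset_right.trans ((disjointed_subset V n).trans interior_subset)

theorem ENNReal.le_of_forall_le_ofReal_one_add_mul {x y : ℝ≥0∞}
    (h : ∀ ε : ℝ, 0 < ε → x ≤ ENNReal.ofReal (1 + ε) * y) : x ≤ y := by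
  have hlim : Tendsto (fun ε : ℝ => ENNReal.ofReal (1 + ε) * y) (𝓝[>] 0) (𝓝 (1 * y)) := by
    have hc : Continuous fun ε : ℝ => ENNReal.ofReal (1 + ε) :=
      ENNReal.continuous_ofReal.comp (continuous_const.add continuous_id)
    have h1 : Tendsto (fun ε : ℝ => ENNReal.ofReal (1 + ε)) (𝓝[>] 0) (𝓝 1) := by
      have := hc.tendsto 0
      simp only [add_zero, ENNReal.ofReal_one] at this
      exact this.mono_left nhdsWithin_le_nhds
    exact ENNReal.Tendsto.mul_const h1 (Or.inl one_ne_zero)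
  rw [one_mul] at hlim
  exact ge_of_tendsto hlim (eventually_mem_nhdsWithin.mono fun ε hε => h ε hε)

section AreaFormula

variable {E : Type*} [NormedAddCommGroup E] [NormedSpace ℝ E] [MeasurableSpace E] [BorelSpace E]

/-- Near each parameter an immersed curve distorts length by a factor close to its speed. -/
theorem hausdorffMeasure_image_comparable {g : ℝ → E} (hg : ContDiff ℝ 1 g)
    (hinj : Function.Injective g) {t₀ : ℝ} {η : ℝ} (hη : 0 < η) (hη' : η < ‖deriv g t₀‖) :
    ∃ U ∈ 𝓝 t₀, ∀ A ⊆ U, MeasurableSet A →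
      Measure.hausdorffMeasure 1 (g '' A) ≤ ENNReal.ofReal (‖deriv g t₀‖ + η) * volume A ∧
      ENNReal.ofReal (‖deriv g t₀‖ - η) * volume A ≤ Measure.hausdorffMeasure 1 (g '' A) ∧
      ∫⁻ t in A, ENNReal.ofReal ‖deriv g t‖ ≤ ENNReal.ofReal (‖deriv g t₀‖ + η) * volume A ∧
      ENNReal.ofReal (‖deriv g t₀‖ - η) * volume A ≤ ∫⁻ t in A, ENNReal.ofReal ‖deriv g t‖ := by
  set m := ‖deriv g t₀‖
  have hmη : 0 < m - η := by linarith
  have hstrict : HasStrictDerivAt g (deriv g t₀) t₀ :=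
    hg.contDiffAt.hasStrictDerivAt one_ne_zero
  have h1 : ∀ᶠ p in 𝓝 (t₀, t₀), ‖g p.1 - g p.2 - (p.1 - p.2) • deriv g t₀‖ ≤ η * ‖p.1 - p.2‖ :=
    hstrict.isLittleO.def hη
  rw [nhds_prod_eq] at h1
  obtain ⟨U₁, hU₁, hU₁'⟩ := eventually_prod_self_iff'.1 h1
  have h2 : ∀ᶠ t in 𝓝 t₀, |‖deriv g t‖ - m| < η := by
    have hc : Continuous fun t => ‖deriv g t‖ := (hg.continuous_deriv le_rfl).norm
    exact Metric.tendsto_nhds.1 (hc.tendsto t₀) η hη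
  refine ⟨U₁ ∩ {t | |‖deriv g t‖ - m| < η}, inter_mem hU₁ h2, fun A hA hAm => ?_⟩
  have hlip : ∀ s ∈ A, ∀ t ∈ A, ‖g s - g t‖ ≤ (m + η) * |s - t| ∧ (m - η) * |s - t| ≤ ‖g s - g t‖ := by
    intro s hs t ht
    have h3 := hU₁' s (hA hs).1 t (hA ht).1
    simp only [Real.norm_eq_abs] at h3
    have h4 : ‖(s - t) • deriv g t₀‖ = m * |s - t| := by
      rw [norm_smul, Real.norm_eq_abs, mul_comm]
    have h5 := abs_le.1 ((abs_norm_sub_norm_le (g s - g t) ((s - t) • deriv g t₀)).trans h3)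
    rw [h4] at h5
    constructor <;> nlinarith [h5.1, h5.2]
  refine ⟨?_, ?_, ?_, ?_⟩
  · have : LipschitzOnWith (Real.toNNReal (m + η)) g A := by
      refine LipschitzOnWith.of_dist_le_mul fun s hs t ht => ?_
      rw [Real.coe_toNNReal _ (by positivity), dist_eq_norm, Real.dist_eq]
      exact (hlip s hs t ht).1
    have := this.hausdorffMeasure_image_le (d := 1) zero_le_one
    rwa [ENNReal.rpow_one, hausdorffMeasure_real] at this
  -- The lower bound comes from the inverse of `g`, which is Lipschitz on the image with constant
  -- `1/(m - η)`.
  · set k := Function.invFun g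
    have hk : ∀ t, k (g t) = t := Function.leftInverse_invFun hinj
    have : LipschitzOnWith (Real.toNNReal (m - η)⁻¹) k (g '' A) := by
      refine LipschitzOnWith.of_dist_le_mul ?_
      rintro _ ⟨s, hs, rfl⟩ _ ⟨t, ht, rfl⟩
      rw [Real.coe_toNNReal _ (by positivity), dist_eq_norm (g s), hk, hk, Real.dist_eq,
        inv_mul_eq_div, le_div_iff₀ hmη, mul_comm]
      exact (hlip s hs t ht).2
    have := this.hausdorffMeasure_image_le (d := 1) zero_le_one
    rw [ENNReal.rpow_one, hausdorffMeasure_real, Set.image_image] at this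
    simp only [hk, Set.image_id'] at this
    calc ENNReal.ofReal (m - η) * volume A
        ≤ ENNReal.ofReal (m - η) * (ENNReal.ofReal (m - η)⁻¹ * Measure.hausdorffMeasure 1 (g '' A)) := by
          gcongr; exact this
      _ = Measure.hausdorffMeasure 1 (g '' A) := by
          rw [← mul_assoc, ← ENNReal.ofReal_mul hmη.le, mul_inv_cancel₀ hmη.ne', ENNReal.ofReal_one,
            one_mul]
  · calc _ ≤ ∫⁻ t in A, ENNReal.ofReal (m + η) := by
          refine setLIntegral_mono measurable_const fun t ht => ENNReal.ofReal_le_ofReal ?_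
          have := abs_lt.1 (show |‖deriv g t‖ - m| < η from (hA ht).2)
          linarith
      _ = _ := by simp
  · calc _ = ∫⁻ t in A, ENNReal.ofReal (m - η) := by simp
      _ ≤ _ := by
          refine setLIntegral_mono' hAm fun t ht => ENNReal.ofReal_le_ofReal ?_
          have := abs_lt.1 (show |‖deriv g t‖ - m| < η from (hA ht).2)
          linarith

/-- The area formula for an injective immersed curve. -/
theorem hausdorffMeasure_image_eq_lintegral_speed {g : ℝ → E} (hg : ContDiff ℝ 1 g)
    (hg0 : ∀ t, deriv g t ≠ 0) (hemb : MeasurableEmbedding g) {A : Set ℝ} (hA : MeasurableSet A) :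
    Measure.hausdorffMeasure 1 (g '' A) = ∫⁻ t in A, ENNReal.ofReal ‖deriv g t‖ := by
  set μ := (Measure.hausdorffMeasure 1 : Measure E).comap g
  set ν := (volume : Measure ℝ).withDensity fun t => ENNReal.ofReal ‖deriv g t‖
  have hμ : ∀ A, μ A = Measure.hausdorffMeasure 1 (g '' A) := fun A => hemb.comap_apply _ A
  have hν : ∀ A, MeasurableSet A → ν A = ∫⁻ t in A, ENNReal.ofReal ‖deriv g t‖ :=
    fun A hA => withDensity_apply _ hA
  have key : ∀ ε : ℝ, 0 < ε → ∀ t₀, ∃ U ∈ 𝓝 t₀, ∀ A ⊆ U, MeasurableSet A →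
      μ A ≤ ENNReal.ofReal (1 + ε) * ν A ∧ ν A ≤ ENNReal.ofReal (1 + ε) * μ A := by
    intro ε hε t₀
    have hm : 0 < ‖deriv g t₀‖ := norm_pos_iff.2 (hg0 t₀)
    set m := ‖deriv g t₀‖
    -- This value solves `m + η = (1 + ε)(m - η)`.
    set η := m * ε / (2 + ε)
    have hη : 0 < η := by positivity
    have hη' : η < m := by
      simp only [η]; rw [div_lt_iff₀ (by positivity)]; nlinarith
    have hc : m + η = (1 + ε) * (m - η) := by
      simp only [η]; field_simp; ring
    obtain ⟨U, hU, hUA⟩ := hausdorffMeasure_image_comparable hg hemb.injective hη hη'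
    refine ⟨U, hU, fun A hA hAm => ?_⟩
    obtain ⟨h1, h2, h3, h4⟩ := hUA A hA hAm
    have hfac : ENNReal.ofReal (m + η) * volume A =
        ENNReal.ofReal (1 + ε) * (ENNReal.ofReal (m - η) * volume A) := by
      rw [hc, ENNReal.ofReal_mul (by positivity), mul_assoc]
    rw [hμ, hν A hAm]
    constructor
    · refine (h1.trans_eq hfac).trans ?_
      gcongr
    · refine (h3.trans_eq hfac).trans ?_
      gcongr
  rw [← hμ, ← hν A hA]
  apply le_antisymm
  · refine ENNReal.le_of_forall_le_ofReal_one_add_mul fun ε hε =>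
      measure_le_const_mul_of_locally (fun x => ?_) hA
    obtain ⟨U, hU, h⟩ := key ε hε x
    exact ⟨U, hU, fun A hA hAm => (h A hA hAm).1⟩
  · refine ENNReal.le_of_forall_le_ofReal_one_add_mul fun ε hε =>
      measure_le_const_mul_of_locally (fun x => ?_) hA
    obtain ⟨U, hU, h⟩ := key ε hε x
    exact ⟨U, hU, fun A hA hAm => (h A hA hAm).2⟩

theorem integral_range_hausdorffMeasure_eq {g : ℝ → E} (hg : ContDiff ℝ 1 g)
    (hg0 : ∀ t, deriv g t ≠ 0) (hemb : MeasurableEmbedding g) (F : E → ℝ) :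
    ∫ x in Set.range g, F x ∂(Measure.hausdorffMeasure 1) = ∫ t, ‖deriv g t‖ * F (g t) := by
  have hc : Continuous fun t => ‖deriv g t‖ := (hg.continuous_deriv le_rfl).norm
  have hmap : (Measure.hausdorffMeasure 1 : Measure E).restrict (Set.range g) =
      Measure.map g ((volume : Measure ℝ).withDensity fun t => ENNReal.ofReal ‖deriv g t‖) := by
    ext B hB
    rw [Measure.restrict_apply hB, hemb.map_apply, withDensity_apply _ (hemb.measurable hB),
      ← hausdorffMeasure_image_eq_lintegral_speed hg hg0 hemb (hemb.measurable hB),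
      Set.image_preimage_eq_inter_range]
  rw [hmap, hemb.integral_map, integral_withDensity_eq_integral_toReal_smul
    (by fun_prop) (by simp)]
  simp

end AreaFormula

/-! ### Length and integrals along the boundary. -/

/-- The parametrisation of the graph of `f` in the coordinates `e`. -/
noncomputable def graphCurve (e : Plane ≃ₗᵢ[ℝ] Plane) (f : ℝ → ℝ) (s : ℝ) : Plane :=
  planeCoord e (s, f s)

theorem contDiff_graphCurve (e : Plane ≃ₗᵢ[ℝ] Plane) {f : ℝ → ℝ} (hf : ContDiff ℝ ∞ f) :
    ContDiff ℝ 1 (graphCurve e f) :=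
  (planeCoord e).contDiff.comp (contDiff_id.prodMk (hf.of_le (by norm_cast)))

theorem deriv_graphCurve (e : Plane ≃ₗᵢ[ℝ] Plane) {f : ℝ → ℝ} (hf : ContDiff ℝ ∞ f) (s : ℝ) :
    deriv (graphCurve e f) s = planeCoord e (1, deriv f s) :=
  ((planeCoord e : ℝ × ℝ →L[ℝ] Plane).hasFDerivAt.comp_hasDerivAt s
    ((hasDerivAt_id s).prodMk (hf.differentiable (by simp) s).hasDerivAt)).deriv

theorem norm_deriv_graphCurve (e : Plane ≃ₗᵢ[ℝ] Plane) {f : ℝ → ℝ} (hf : ContDiff ℝ ∞ f) (s : ℝ) :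
    ‖deriv (graphCurve e f) s‖ = graphSpeed f s := by
  rw [deriv_graphCurve e hf, norm_planeCoord, graphSpeed, one_pow]

theorem deriv_graphCurve_ne_zero (e : Plane ≃ₗᵢ[ℝ] Plane) {f : ℝ → ℝ} (hf : ContDiff ℝ ∞ f) (s : ℝ) :
    deriv (graphCurve e f) s ≠ 0 := by
  rw [← norm_pos_iff, norm_deriv_graphCurve e hf]; exact graphSpeed_pos f s

theorem measurableEmbedding_graphCurve (e : Plane ≃ₗᵢ[ℝ] Plane) {f : ℝ → ℝ} (hf : ContDiff ℝ ∞ f) :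
    MeasurableEmbedding (graphCurve e f) := by
  refine (contDiff_graphCurve e hf).continuous.measurableEmbedding fun s t hst => ?_
  have := (planeCoord e).injective hst
  exact congrArg Prod.fst this

theorem mem_range_graphCurve_iff (e : Plane ≃ₗᵢ[ℝ] Plane) (f : ℝ → ℝ) (y : Plane) :
    y ∈ Set.range (graphCurve e f) ↔ (e y) 1 = f ((e y) 0) := by
  constructor
  · rintro ⟨s, rfl⟩; simp [graphCurve]
  · intro h
    refine ⟨(e y) 0, ?_⟩
    rw [graphCurve, ← h]
    exact (planeCoord e).apply_symm_apply y

/-- Outside `U` the boundary and the graph need not coincide, but `F` vanishes there, so one may be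
exchanged for the other. -/
theorem IsGraphChart.integral_frontier_eq {Ω U : Set Plane} {e : Plane ≃ₗᵢ[ℝ] Plane} {f : ℝ → ℝ}
    (h : IsGraphChart Ω U e f) (hΩ : IsOpen Ω) {F : Plane → ℝ} (hF : ∀ y ∉ U, F y = 0) :
    ∫ y in frontier Ω, F y ∂(Measure.hausdorffMeasure 1) =
      ∫ s, graphSpeed f s * F (graphCurve e f s) := by
  have hg := contDiff_graphCurve e h.contDiff
  have hemb := measurableEmbedding_graphCurve e h.contDiff
  simp_rw [← norm_deriv_graphCurve e h.contDiff]
  rw [← integral_range_hausdorffMeasure_eq hg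
    (deriv_graphCurve_ne_zero e h.contDiff) hemb,
    ← integral_indicator isClosed_frontier.measurableSet,
    ← integral_indicator hemb.measurableSet_range]
  refine integral_congr_ae (Eventually.of_forall fun y => ?_)
  classical
  by_cases hy : y ∈ U
  · simp only [Set.indicator_apply, mem_range_graphCurve_iff, h.mem_frontier_iff hΩ hy]
  · simp only [Set.indicator_apply, hF y hy, ite_self]

theorem IsRegularSet.isCompact_frontier {Ω : Set Plane} (hΩ : IsRegularSet Ω) :
    IsCompact (frontier Ω) :=
  Metric.isCompact_of_isClosed_isBounded isClosed_frontier
    (hΩ.isBounded.closure.subset frontier_subset_closure)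

theorem IsRegularSet.hausdorffMeasure_frontier_lt_top {Ω : Set Plane} (hΩ : IsRegularSet Ω) :
    Measure.hausdorffMeasure 1 (frontier Ω) < ⊤ := by
  refine hΩ.isCompact_frontier.measure_lt_top_of_nhdsWithin fun x hx => ?_
  obtain ⟨r, e, f, hr, h⟩ := hΩ.exists_isGraphChart hx
  refine ⟨frontier Ω ∩ Metric.ball x r, inter_mem_nhdsWithin _ (Metric.ball_mem_nhds x hr), ?_⟩
  set I := Metric.closedBall ((e x) 0) r
  have hsub : frontier Ω ∩ Metric.ball x r ⊆ graphCurve e f '' I := by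
    rintro y ⟨hy, hyU⟩
    have h1 := (h.mem_frontier_iff hΩ.isOpen hyU).1 hy
    refine ⟨(e y) 0, ?_, ?_⟩
    · have := abs_coord_le_norm e (y - x) 0
      rw [map_sub, PiLp.sub_apply] at this
      rw [Metric.mem_ball, dist_eq_norm] at hyU
      rw [Metric.mem_closedBall, Real.dist_eq]
      linarith
    · rw [graphCurve, ← h1]
      exact (planeCoord e).apply_symm_apply y
  refine (measure_mono hsub).trans_lt ?_
  rw [hausdorffMeasure_image_eq_lintegral_speed (contDiff_graphCurve e h.contDiff)
    (deriv_graphCurve_ne_zero e h.contDiff) (measurableEmbedding_graphCurve e h.contDiff)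
    Metric.isClosed_closedBall.measurableSet]
  have hc : Continuous fun t => ‖deriv (graphCurve e f) t‖ :=
    ((contDiff_graphCurve e h.contDiff).continuous_deriv le_rfl).norm
  have hint : IntegrableOn (fun t => ‖deriv (graphCurve e f) t‖) I :=
    hc.continuousOn.integrableOn_compact (isCompact_closedBall _ _)
  exact hint.lintegral_lt_top

/-! ### The divergence theorem in one chart. -/

section Subgraph

theorem hasCompactSupport_slice_right {G : ℝ × ℝ → ℝ} (hG : HasCompactSupport G) (s : ℝ) :
    HasCompactSupport fun u => G (s, u) := by
  refine HasCompactSupport.intro (hG.isCompact.image continuous_snd) fun u hu => ?_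
  exact image_eq_zero_of_notMem_tsupport fun h => hu ⟨_, h, rfl⟩

theorem hasCompactSupport_slice_left {G : ℝ × ℝ → ℝ} (hG : HasCompactSupport G) (u : ℝ) :
    HasCompactSupport fun s => G (s, u) := by
  refine HasCompactSupport.intro (hG.isCompact.image continuous_fst) fun s hs => ?_
  exact image_eq_zero_of_notMem_tsupport fun h => hs ⟨_, h, rfl⟩

theorem hasDerivAt_slice_right {G : ℝ × ℝ → ℝ} (hG : ContDiff ℝ 1 G) (s u : ℝ) :
    HasDerivAt (fun u => G (s, u)) (fderiv ℝ G (s, u) (0, 1)) u :=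
  ((hG.differentiable one_ne_zero (s, u)).hasFDerivAt).comp_hasDerivAt u
    ((hasDerivAt_const u s).prodMk (hasDerivAt_id u))

theorem hasDerivAt_slice_left {G : ℝ × ℝ → ℝ} (hG : ContDiff ℝ 1 G) (s u : ℝ) :
    HasDerivAt (fun s => G (s, u)) (fderiv ℝ G (s, u) (1, 0)) s :=
  ((hG.differentiable one_ne_zero (s, u)).hasFDerivAt).comp_hasDerivAt s
    ((hasDerivAt_id s).prodMk (hasDerivAt_const s u))

theorem continuous_fderiv_apply_const {E F : Type*} [NormedAddCommGroup E] [NormedSpace ℝ E]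
    [NormedAddCommGroup F] [NormedSpace ℝ F] {G : E → F} (hG : ContDiff ℝ 1 G) (v : E) :
    Continuous fun p => fderiv ℝ G p v :=
  (hG.continuous_fderiv one_ne_zero).clm_apply continuous_const

theorem integral_lowerHalfPlane_fderiv_snd {G : ℝ × ℝ → ℝ} (hG : ContDiff ℝ 1 G)
    (hGc : HasCompactSupport G) {w : ℝ → ℝ} (hw : Continuous w) :
    ∫ q in Set.univ ×ˢ Set.Iio 0, w q.1 * fderiv ℝ G q (0, 1) = ∫ s, w s * G (s, 0) := by
  have hc : Continuous fun q : ℝ × ℝ => w q.1 * fderiv ℝ G q (0, 1) :=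
    (hw.comp continuous_fst).mul (continuous_fderiv_apply_const hG _)
  have hcs : HasCompactSupport fun q : ℝ × ℝ => w q.1 * fderiv ℝ G q (0, 1) :=
    (hGc.fderiv_apply ℝ (0, 1)).mul_left
  rw [Measure.volume_eq_prod, setIntegral_prod _ (hc.integrable_of_hasCompactSupport hcs).integrableOn,
    Measure.restrict_univ]
  congr 1
  ext s
  simp only
  rw [integral_const_mul, ← integral_Iic_eq_integral_Iio]
  congr 1
  have h1 : ContDiff ℝ 1 fun u => G (s, u) := hG.comp (contDiff_const.prodMk contDiff_id)
  rw [← (hasCompactSupport_slice_right hGc s).integral_Iic_deriv_eq h1 0]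
  congr 1
  ext u
  exact (hasDerivAt_slice_right hG s u).deriv.symm

theorem integral_lowerHalfPlane_fderiv_fst {G : ℝ × ℝ → ℝ} (hG : ContDiff ℝ 1 G)
    (hGc : HasCompactSupport G) :
    ∫ q in Set.univ ×ˢ Set.Iio 0, fderiv ℝ G q (1, 0) = 0 := by
  have hc := continuous_fderiv_apply_const hG ((1, 0) : ℝ × ℝ)
  have hcs : HasCompactSupport fun q : ℝ × ℝ => fderiv ℝ G q (1, 0) := hGc.fderiv_apply ℝ (1, 0)
  have hint := (hc.integrable_of_hasCompactSupport (μ := volume) hcs)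
  rw [Measure.volume_eq_prod, ← Measure.prod_restrict, integral_prod_symm, Measure.restrict_univ]
  · refine integral_eq_zero_of_ae (Eventually.of_forall fun u => ?_)
    have h1 : ContDiff ℝ 1 fun s => G (s, u) := hG.comp (contDiff_id.prodMk contDiff_const)
    have h2 := hasCompactSupport_slice_left hGc u
    have h3 := hasCompactSupport_slice_left hcs u
    refine integral_eq_zero_of_hasDerivAt_of_integrable (hasDerivAt_slice_left hG · u) ?_ ?_
    · exact Continuous.integrable_of_hasCompactSupport
        (hc.comp (continuous_id.prodMk continuous_const)) h3
    · exact h1.continuous.integrable_of_hasCompactSupport h2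
  · rw [Measure.prod_restrict]
    exact hint.integrableOn

/-- The shear `(s, u) ↦ (s, u + f s)`. -/
def shear {f : ℝ → ℝ} (hf : Continuous f) : (ℝ × ℝ) ≃ₜ (ℝ × ℝ) where
  toFun p := (p.1, p.2 + f p.1)
  invFun p := (p.1, p.2 - f p.1)
  left_inv p := by simp
  right_inv p := by simp
  continuous_toFun := by fun_prop
  continuous_invFun := by fun_prop

theorem measurePreserving_shear {f : ℝ → ℝ} (hf : Continuous f) : MeasurePreserving (shear hf) := by
  refine (MeasurePreserving.id volume).skew_product (g := fun s u => u + f s) ?_ ?_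
  · exact (measurable_snd.add (hf.measurable.comp measurable_fst))
  · exact Eventually.of_forall fun s => map_add_right_eq_self volume (f s)

/-- A shear flattens the subgraph to a half-plane without changing area. -/
theorem setIntegral_subgraph {f : ℝ → ℝ} (hf : Continuous f) (F : ℝ × ℝ → ℝ) :
    ∫ p in {p : ℝ × ℝ | p.2 < f p.1}, F p = ∫ q in Set.univ ×ˢ Set.Iio 0, F (shear hf q) := by
  rw [← (measurePreserving_shear hf).setIntegral_preimage_emb (shear hf).measurableEmbedding]
  congr 2
  ext q
  simp [shear]

variable {g : ℝ × ℝ → ℝ} {f : ℝ → ℝ}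

theorem fderiv_comp_shear (hg : ContDiff ℝ 1 g) (hf : ContDiff ℝ 1 f) (q v : ℝ × ℝ) :
    fderiv ℝ (g ∘ shear hf.continuous) q v =
      fderiv ℝ g (shear hf.continuous q) (v.1, v.2 + deriv f q.1 * v.1) := by
  have h1 : HasFDerivAt (fun q : ℝ × ℝ => (q.1, q.2 + f q.1))
      ((ContinuousLinearMap.fst ℝ ℝ ℝ).prod (ContinuousLinearMap.snd ℝ ℝ ℝ +
        (deriv f q.1) • ContinuousLinearMap.fst ℝ ℝ ℝ)) q :=
    hasFDerivAt_fst.prodMk (hasFDerivAt_snd.add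
      ((hf.differentiable one_ne_zero q.1).hasDerivAt.comp_hasFDerivAt q hasFDerivAt_fst))
  have h2 := ((hg.differentiable one_ne_zero (shear hf.continuous q)).hasFDerivAt).comp q h1
  have h3 : fderiv ℝ (g ∘ shear hf.continuous) q = _ := h2.fderiv
  rw [h3]
  simp

theorem contDiff_comp_shear (hg : ContDiff ℝ 1 g) (hf : ContDiff ℝ 1 f) :
    ContDiff ℝ 1 (g ∘ shear hf.continuous) :=
  hg.comp (contDiff_fst.prodMk (contDiff_snd.add (hf.comp contDiff_fst)))

theorem integral_subgraph_fderiv_snd (hg : ContDiff ℝ 1 g) (hgc : HasCompactSupport g)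
    (hf : ContDiff ℝ 1 f) :
    ∫ p in {p : ℝ × ℝ | p.2 < f p.1}, fderiv ℝ g p (0, 1) = ∫ s, g (s, f s) := by
  have h := integral_lowerHalfPlane_fderiv_snd (contDiff_comp_shear hg hf)
    (hgc.comp_homeomorph (shear hf.continuous)) (w := fun _ => 1) continuous_const
  simp only [fderiv_comp_shear hg hf, one_mul, mul_zero, add_zero] at h
  rw [setIntegral_subgraph hf.continuous, h]
  simp [shear]

theorem integral_subgraph_fderiv_fst (hg : ContDiff ℝ 1 g) (hgc : HasCompactSupport g)
    (hf : ContDiff ℝ 1 f) :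
    ∫ p in {p : ℝ × ℝ | p.2 < f p.1}, fderiv ℝ g p (1, 0) = -∫ s, deriv f s * g (s, f s) := by
  have hG := contDiff_comp_shear hg hf
  have hGc := hgc.comp_homeomorph (shear hf.continuous)
  have hd : Continuous (deriv f) := hf.continuous_deriv le_rfl
  have h1 := integral_lowerHalfPlane_fderiv_fst hG hGc
  have h2 := integral_lowerHalfPlane_fderiv_snd hG hGc hd
  have hi1 : Integrable fun q => fderiv ℝ (g ∘ shear hf.continuous) q (1, 0) :=
    (continuous_fderiv_apply_const hG _).integrable_of_hasCompactSupport (hGc.fderiv_apply ℝ _)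
  have hi2 : Integrable fun q : ℝ × ℝ =>
      deriv f q.1 * fderiv ℝ (g ∘ shear hf.continuous) q (0, 1) :=
    ((hd.comp continuous_fst).mul (continuous_fderiv_apply_const hG _)).integrable_of_hasCompactSupport
      (hGc.fderiv_apply ℝ (0, 1)).mul_left
  rw [setIntegral_subgraph hf.continuous]
  -- By the chain rule, `∂₁g = ∂₁G - f' ∂₂G` for the sheared `G`. The first term integrates to zero
  -- along horizontal lines and the second leaves a boundary term weighted by `f'`.
  have hpt : ∀ q : ℝ × ℝ, fderiv ℝ g (shear hf.continuous q) (1, 0) =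
      fderiv ℝ (g ∘ shear hf.continuous) q (1, 0) -
        deriv f q.1 * fderiv ℝ (g ∘ shear hf.continuous) q (0, 1) := by
    intro q
    rw [fderiv_comp_shear hg hf, fderiv_comp_shear hg hf,
      ← smul_eq_mul (deriv f q.1) (fderiv ℝ g _ _), ← map_smul, ← map_sub]
    congr 1
    ext <;> simp
  simp_rw [hpt]
  rw [integral_sub hi1.integrableOn hi2.integrableOn, h1, h2, zero_sub]
  simp [shear]

end Subgraph

theorem planeDiv_add {S T : Plane → Plane} {x : Plane} (hS : DifferentiableAt ℝ S x)
    (hT : DifferentiableAt ℝ T x) : planeDiv (S + T) x = planeDiv S x + planeDiv T x := by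
  simp only [planeDiv, fderiv_add hS hT, Fin.sum_univ_two]
  simp
  ring

theorem planeDiv_of_notMem_tsupport {T : Plane → Plane} {x : Plane} (hx : x ∉ tsupport T) :
    planeDiv T x = 0 := by
  simp [planeDiv, fderiv_of_notMem_tsupport ℝ hx]

theorem continuous_planeDiv {T : Plane → Plane} (hT : ContDiff ℝ 1 T) : Continuous (planeDiv T) := by
  unfold planeDiv
  refine continuous_finsetSum _ fun i _ => ?_
  exact (EuclideanSpace.proj (𝕜 := ℝ) i).continuous.comp (continuous_fderiv_apply_const hT _)

theorem IsGraphChart.integral_planeDiv {Ω U : Set Plane} {e : Plane ≃ₗᵢ[ℝ] Plane} {f : ℝ → ℝ}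
    (h : IsGraphChart Ω U e f) (hΩ : IsOpen Ω) {T : Plane → Plane} (hT : ContDiff ℝ 1 T)
    (hTc : HasCompactSupport T) (hTU : tsupport T ⊆ U) :
    ∫ x in Ω, planeDiv T x =
      ∫ y in frontier Ω, inner ℝ (T y) (chartNormal e f y) ∂(Measure.hausdorffMeasure 1) := by
  have hf1 : ContDiff ℝ 1 f := h.contDiff.of_le (by norm_cast)
  set S : Fin 2 → ℝ × ℝ → ℝ := fun i p => (e (T (planeCoord e p))) i
  have hS : ∀ i, ContDiff ℝ 1 (S i) := fun i =>
    (contDiff_coord e i).comp (hT.comp (planeCoord e).contDiff)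
  have hSc : ∀ i, HasCompactSupport (S i) := fun i =>
    (hTc.comp_homeomorph (planeCoord e).toHomeomorph).comp_left (g := fun z => (e z) i) (by simp)
  have hSd : ∀ i p v, fderiv ℝ (S i) p v = (e (fderiv ℝ T (planeCoord e p) (planeCoord e v))) i := by
    intro i p v
    have h1 := (hT.differentiable one_ne_zero (planeCoord e p)).hasFDerivAt.comp p
      (planeCoord e : ℝ × ℝ →L[ℝ] Plane).hasFDerivAt
    have h2 := ((EuclideanSpace.proj (𝕜 := ℝ) i).comp
      (e.toContinuousLinearEquiv : Plane →L[ℝ] Plane)).hasFDerivAt.comp p h1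
    have h3 : fderiv ℝ (S i) p = _ := h2.fderiv
    rw [h3]
    rfl
  have hmeas : MeasurableSet {p : ℝ × ℝ | p.2 < f p.1} :=
    measurableSet_lt measurable_snd (hf1.continuous.measurable.comp measurable_fst)
  have hleft : ∫ x in Ω, planeDiv T x = ∫ p in {p : ℝ × ℝ | p.2 < f p.1},
      (fderiv ℝ (S 0) p (1, 0) + fderiv ℝ (S 1) p (0, 1)) := by
    rw [← integral_indicator hΩ.measurableSet, ← (measurePreserving_planeCoord e).integral_comp
      (measurableEmbedding_planeCoord e), ← integral_indicator hmeas]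
    refine integral_congr_ae (Eventually.of_forall fun p => ?_)
    classical
    simp only [Set.indicator_apply, hSd, ← planeDiv_eq_isometry]
    by_cases hp : planeCoord e p ∈ U
    · simp [h.mem_iff _ hp]
    · rw [planeDiv_of_notMem_tsupport fun hx => hp (hTU hx)]; simp
  have hiS : ∀ i v, Integrable fun p => fderiv ℝ (S i) p v := fun i v =>
    (continuous_fderiv_apply_const (hS i) v).integrable_of_hasCompactSupport
      ((hSc i).fderiv_apply ℝ v)
  rw [hleft, integral_add (hiS 0 _).integrableOn (hiS 1 _).integrableOn,
    integral_subgraph_fderiv_fst (hS 0) (hSc 0) hf1, integral_subgraph_fderiv_snd (hS 1) (hSc 1) hf1,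
    h.integral_frontier_eq hΩ, neg_add_eq_sub, ← integral_sub]
  · congr 1
    ext s
    rw [real_inner_comm]
    have := graphSpeed_mul_inner_chartNormal e f (graphCurve e f s) (T (graphCurve e f s))
    simp only [graphCurve, apply_planeCoord_zero] at this ⊢
    rw [this]
  · refine Continuous.integrable_of_hasCompactSupport
      ((hS 1).continuous.comp (continuous_id.prodMk hf1.continuous)) ?_
    refine HasCompactSupport.intro ((hSc 1).isCompact.image continuous_fst) fun s hs => ?_
    exact image_eq_zero_of_notMem_tsupport fun h => hs ⟨_, h, rfl⟩
  · refine Continuous.integrable_of_hasCompactSupport ((hf1.continuous_deriv le_rfl).mul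
      ((hS 0).continuous.comp (continuous_id.prodMk hf1.continuous))) (HasCompactSupport.mul_left ?_)
    refine HasCompactSupport.intro ((hSc 0).isCompact.image continuous_fst) fun s hs => ?_
    exact image_eq_zero_of_notMem_tsupport fun h => hs ⟨_, h, rfl⟩
  · intro y hy
    rw [image_eq_zero_of_notMem_tsupport fun h => hy (hTU h), inner_zero_left]

/-- Integrability replaces compact support here, since the flux field decays only exponentially. -/
theorem integral_planeDiv_eq_zero {T : Plane → Plane} (hT : Differentiable ℝ T)
    (hi : Integrable T) (hd : ∀ v, Integrable fun x => fderiv ℝ T x v) :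
    ∫ x, planeDiv T x = 0 := by
  have hz : ∀ v, ∫ x, fderiv ℝ T x v = 0 := by
    intro v
    have := integral_smul_fderiv_eq_neg_fderiv_smul_of_integrable (μ := volume)
      (f := fun _ : Plane => (1 : ℝ)) (g := T) (v := v) (by simp) (by simpa using hd v)
      (by simpa using hi) (fun x _ => differentiableAt_const _) (fun x _ => hT x)
    simpa using this
  have hc : ∀ (i : Fin 2) v, ∫ x, (fderiv ℝ T x v) i = 0 := by
    intro i v
    have := (EuclideanSpace.proj (𝕜 := ℝ) i : Plane →L[ℝ] ℝ).integral_comp_comm (hd v)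
    simp only [hz, map_zero] at this
    exact this
  unfold planeDiv
  rw [integral_finsetSum]
  · simp [hc]
  · intro i _
    exact (EuclideanSpace.proj (𝕜 := ℝ) i : Plane →L[ℝ] ℝ).integrable_comp (hd _)

/-! ### Globalisation: normal field, divergence theorem, perimeter. -/

open scoped Manifold in
/-- A smooth partition of unity on the closure of a regular set, subordinate to the set itself and
to finitely many graph charts along its boundary. -/
theorem IsRegularSet.exists_partition {Ω : Set Plane} (hΩ : IsRegularSet Ω) :
    ∃ (ι : Type) (_ : Fintype ι) (U : ι → Set Plane) (e : ι → (Plane ≃ₗᵢ[ℝ] Plane))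
      (f : ι → ℝ → ℝ) (φ₀ : Plane → ℝ) (φ : ι → Plane → ℝ),
      (∀ i, IsGraphChart Ω (U i) (e i) (f i)) ∧
      ContDiff ℝ 1 φ₀ ∧ HasCompactSupport φ₀ ∧ tsupport φ₀ ⊆ Ω ∧
      (∀ i, ContDiff ℝ 1 (φ i)) ∧ (∀ i, HasCompactSupport (φ i)) ∧ (∀ i, tsupport (φ i) ⊆ U i) ∧
      (∀ i x, 0 ≤ φ i x) ∧ (∀ x, ∑ i, φ i x ≤ 1) ∧ ∀ x ∈ closure Ω, φ₀ x + ∑ i, φ i x = 1 := by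
  choose! r e f hr hch using fun x (hx : x ∈ frontier Ω) => hΩ.exists_isGraphChart hx
  obtain ⟨t, ht, hcov⟩ := hΩ.isCompact_frontier.elim_nhds_subcover (fun x => Metric.ball x (r x))
    fun x hx => Metric.ball_mem_nhds x (hr x hx)
  -- The index `none` stands for the interior piece `Ω`, the indices `some x` for the boundary
  -- charts.
  let V : Option t → Set Plane := fun o => o.elim Ω fun x => Metric.ball x (r x)
  have hVo : ∀ o, IsOpen (V o) := by
    rintro (_ | x)
    · exact hΩ.isOpen
    · exact Metric.isOpen_ball
  have hVcov : closure Ω ⊆ ⋃ o, V o := by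
    intro x hx
    by_cases hxΩ : x ∈ Ω
    · exact Set.mem_iUnion.2 ⟨none, hxΩ⟩
    · have : x ∈ frontier Ω := by rw [hΩ.isOpen.frontier_eq]; exact ⟨hx, hxΩ⟩
      obtain ⟨y, hy, hxy⟩ := Set.mem_iUnion₂.1 (hcov this)
      exact Set.mem_iUnion.2 ⟨some ⟨y, hy⟩, hxy⟩
  obtain ⟨ρ, hρ⟩ := SmoothPartitionOfUnity.exists_isSubordinate 𝓘(ℝ, Plane) isClosed_closure V hVo hVcov
  have hsm : ∀ o, ContDiff ℝ 1 (ρ o) := fun o => ((ρ o).contMDiff.contDiff).of_le (by norm_cast)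
  have hcs : ∀ o, HasCompactSupport (ρ o) := by
    intro o
    refine Metric.isCompact_of_isClosed_isBounded (isClosed_tsupport _) (Bornology.IsBounded.subset ?_ (hρ o))
    rcases o with (_ | x)
    · exact hΩ.isBounded
    · exact Metric.isBounded_ball
  have hsum : ∀ x, ∑ᶠ o, ρ o x = ρ none x + ∑ i : t, ρ (some i) x := by
    intro x
    rw [finsum_eq_sum_of_fintype, Fintype.sum_option]
  refine ⟨t, inferInstance, fun x => Metric.ball x (r x), fun x => e x, fun x => f x, ρ none,
    fun x => ρ (some x), fun x => hch x (ht x x.2), hsm _, hcs _, hρ none, fun x => hsm _,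
    fun x => hcs _, fun x => hρ (some x), fun i x => ρ.nonneg _ x, fun x => ?_, fun x hx => ?_⟩
  · have h1 := ρ.sum_le_one x
    have h2 := ρ.nonneg none x
    rw [hsum] at h1
    linarith
  · rw [← hsum]; exact ρ.sum_eq_one hx

/-- A vector field which on the boundary of `Ω` is the outer unit normal. -/
structure IsNormalField (Ω : Set Plane) (n : Plane → Plane) : Prop where
  contDiff : ContDiff ℝ 1 n
  hasCompactSupport : HasCompactSupport n
  norm_le_one : ∀ x, ‖n x‖ ≤ 1
  eq_chartNormal : ∀ y ∈ frontier Ω, ∀ U e f, IsGraphChart Ω U e f → y ∈ U → n y = chartNormal e f y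

/-- Chart normals are glued with the partition of unity. On the boundary they agree and the weights
sum to 1; elsewhere the weights sum to at most 1, which keeps the norm at most 1, so the field is a
competitor for the perimeter. -/
theorem IsRegularSet.exists_isNormalField {Ω : Set Plane} (hΩ : IsRegularSet Ω) :
    ∃ n, IsNormalField Ω n := by
  obtain ⟨ι, _, U, e, f, φ₀, φ, hch, hφ₀, hφ₀c, hφ₀Ω, hφ, hφc, hφU, hpos, hle, hone⟩ :=
    hΩ.exists_partition
  refine ⟨fun x => ∑ i, φ i x • chartNormal (e i) (f i) x, ?_, ?_, ?_, ?_⟩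
  · exact ContDiff.sum fun i _ => (hφ i).smul
      ((contDiff_chartNormal (e i) (hch i).contDiff).of_le (by norm_cast))
  · refine HasCompactSupport.intro (isCompact_iUnion fun i => (hφc i).isCompact) fun x hx => ?_
    refine Finset.sum_eq_zero fun i _ => ?_
    rw [image_eq_zero_of_notMem_tsupport fun h => hx (Set.mem_iUnion.2 ⟨i, h⟩), zero_smul]
  · intro x
    refine (norm_sum_le _ _).trans (le_trans (Finset.sum_le_sum fun i _ => ?_) (hle x))
    rw [norm_smul, norm_chartNormal, mul_one, Real.norm_eq_abs, abs_of_nonneg (hpos i x)]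
  · intro y hy U' e' f' h' hyU'
    have hsum : ∑ i, φ i y = 1 := by
      have := hone y (frontier_subset_closure hy)
      rwa [image_eq_zero_of_notMem_tsupport (f := φ₀) (fun h => ?_), zero_add] at this
      rw [hΩ.isOpen.frontier_eq] at hy
      exact hy.2 (hφ₀Ω h)
    have : ∀ i, φ i y • chartNormal (e i) (f i) y = φ i y • chartNormal e' f' y := by
      intro i
      by_cases hyi : y ∈ tsupport (φ i)
      · rw [(hch i).chartNormal_eq h' hΩ.isOpen (hφU i hyi) hyU' hy]
      · rw [image_eq_zero_of_notMem_tsupport hyi, zero_smul, zero_smul]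
    simp only [this, ← Finset.sum_smul, hsum, one_smul]

section Divergence

variable {Ω : Set Plane}

theorem IsRegularSet.isFiniteMeasure_frontier (hΩ : IsRegularSet Ω) :
    IsFiniteMeasure ((Measure.hausdorffMeasure 1 : Measure Plane).restrict (frontier Ω)) :=
  isFiniteMeasure_restrict.2 hΩ.hausdorffMeasure_frontier_lt_top.ne

theorem IsRegularSet.integrableOn_frontier (hΩ : IsRegularSet Ω) {F : Plane → ℝ}
    (hF : ContinuousOn F (frontier Ω)) :
    IntegrableOn F (frontier Ω) (Measure.hausdorffMeasure 1) := by
  have := hΩ.isFiniteMeasure_frontier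
  obtain ⟨C, hC⟩ := hΩ.isCompact_frontier.exists_bound_of_continuousOn hF
  exact Integrable.of_bound (hF.aestronglyMeasurable isClosed_frontier.measurableSet) C
    ((ae_restrict_iff' isClosed_frontier.measurableSet).2 (Eventually.of_forall hC))

theorem IsNormalField.norm_eq_one (hΩ : IsRegularSet Ω) {n : Plane → Plane}
    (hn : IsNormalField Ω n) {y : Plane} (hy : y ∈ frontier Ω) : ‖n y‖ = 1 := by
  obtain ⟨r, e, f, hr, h⟩ := hΩ.exists_isGraphChart hy
  rw [hn.eq_chartNormal y hy _ e f h (Metric.mem_ball_self hr), norm_chartNormal]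

theorem integral_planeDiv_of_tsupport_subset {T : Plane → Plane} (hT : ContDiff ℝ 1 T)
    (hTc : HasCompactSupport T) (hTΩ : tsupport T ⊆ Ω) : ∫ x in Ω, planeDiv T x = 0 := by
  rw [setIntegral_eq_integral_of_forall_compl_eq_zero fun x hx =>
    planeDiv_of_notMem_tsupport fun h => hx (hTΩ h)]
  exact integral_planeDiv_eq_zero (hT.differentiable one_ne_zero)
    (hT.continuous.integrable_of_hasCompactSupport hTc) fun v =>
    (continuous_fderiv_apply_const hT v).integrable_of_hasCompactSupport (hTc.fderiv_apply ℝ v)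

theorem planeDiv_sum {ι : Type*} (s : Finset ι) {T : ι → Plane → Plane} {x : Plane}
    (hT : ∀ i, DifferentiableAt ℝ (T i) x) :
    planeDiv (fun z => ∑ i ∈ s, T i z) x = ∑ i ∈ s, planeDiv (T i) x := by
  simp only [planeDiv, fderiv_fun_sum fun i _ => hT i]
  rw [Finset.sum_comm]
  simp

/-- The divergence theorem on a regular set. -/
theorem IsRegularSet.integral_planeDiv (hΩ : IsRegularSet Ω) {n : Plane → Plane}
    (hn : IsNormalField Ω n) {T : Plane → Plane} (hT : ContDiff ℝ 1 T) :
    ∫ x in Ω, planeDiv T x = ∫ y in frontier Ω, inner ℝ (T y) (n y) ∂(Measure.hausdorffMeasure 1) := by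
  obtain ⟨ι, _, U, e, f, φ₀, φ, hch, hφ₀, hφ₀c, hφ₀Ω, hφ, hφc, hφU, hpos, hle, hone⟩ :=
    hΩ.exists_partition
  have hφT : ∀ i, ContDiff ℝ 1 fun x => φ i x • T x := fun i => (hφ i).smul hT
  have hφTc : ∀ i, HasCompactSupport fun x => φ i x • T x := fun i => (hφc i).smul_right
  have hφTs : ∀ i, tsupport (fun x => φ i x • T x) ⊆ tsupport (φ i) := fun i =>
    tsupport_smul_subset_left (φ i) T
  have h0T : ContDiff ℝ 1 fun x => φ₀ x • T x := hφ₀.smul hT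
  have h0Tc : HasCompactSupport fun x => φ₀ x • T x := hφ₀c.smul_right
  have h0Ts : tsupport (fun x => φ₀ x • T x) ⊆ Ω := (tsupport_smul_subset_left φ₀ T).trans hφ₀Ω
  have hint : ∀ S : Plane → Plane, ContDiff ℝ 1 S → IntegrableOn (planeDiv S) Ω := fun S hS =>
    ((continuous_planeDiv hS).continuousOn.integrableOn_compact
      (hΩ.isBounded.isCompact_closure)).mono_set subset_closure
  have hdiv : ∀ x ∈ Ω, planeDiv T x =
      planeDiv (fun x => φ₀ x • T x) x + ∑ i, planeDiv (fun x => φ i x • T x) x := by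
    intro x hx
    have heq : T =ᶠ[𝓝 x] (fun x => φ₀ x • T x) + fun x => ∑ i, φ i x • T x := by
      filter_upwards [hΩ.isOpen.mem_nhds hx] with z hz
      rw [Pi.add_apply, ← Finset.sum_smul, ← add_smul, hone z (subset_closure hz), one_smul]
    have h1 : planeDiv T x = planeDiv ((fun x => φ₀ x • T x) + fun x => ∑ i, φ i x • T x) x := by
      simp only [planeDiv, heq.fderiv_eq]
    rw [h1, planeDiv_add (h0T.differentiable one_ne_zero x)
      ((ContDiff.sum fun i _ => hφT i).differentiable one_ne_zero x),
      planeDiv_sum _ fun i => (hφT i).differentiable one_ne_zero x]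
  rw [setIntegral_congr_fun hΩ.isOpen.measurableSet hdiv, integral_add (hint _ h0T)
    (integrable_finsetSum _ fun i _ => hint _ (hφT i)), integral_finsetSum _ fun i _ => hint _ (hφT i),
    integral_planeDiv_of_tsupport_subset h0T h0Tc h0Ts, zero_add]
  have hbd : ∀ i, ∫ x in Ω, planeDiv (fun x => φ i x • T x) x =
      ∫ y in frontier Ω, φ i y * inner ℝ (T y) (n y) ∂(Measure.hausdorffMeasure 1) := by
    intro i
    rw [(hch i).integral_planeDiv hΩ.isOpen (hφT i) (hφTc i) ((hφTs i).trans (hφU i))]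
    refine setIntegral_congr_fun isClosed_frontier.measurableSet fun y hy => ?_
    by_cases hyi : y ∈ tsupport (φ i)
    · simp only [hn.eq_chartNormal y hy _ _ _ (hch i) (hφU i hyi), real_inner_smul_left]
    · simp only [image_eq_zero_of_notMem_tsupport hyi, zero_smul, inner_zero_left, zero_mul]
  simp only [hbd]
  rw [← integral_finsetSum]
  · refine setIntegral_congr_fun isClosed_frontier.measurableSet fun y hy => ?_
    have hsum : ∑ i, φ i y = 1 := by
      have := hone y (frontier_subset_closure hy)
      rwa [image_eq_zero_of_notMem_tsupport (f := φ₀) (fun h => ?_), zero_add] at this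
      rw [hΩ.isOpen.frontier_eq] at hy
      exact hy.2 (hφ₀Ω h)
    simp only [← Finset.sum_mul, hsum, one_mul]
  · intro i _
    refine hΩ.integrableOn_frontier (Continuous.continuousOn ?_)
    exact (hφ i).continuous.mul (hT.continuous.inner hn.contDiff.continuous)

/-- Cauchy–Schwarz on the boundary flux gives the upper bound, and the normal field itself attains
it. -/
theorem IsRegularSet.perimeter_eq (hΩ : IsRegularSet Ω) :
    perimeter Ω = Measure.hausdorffMeasure 1 (frontier Ω) := by
  obtain ⟨n, hn⟩ := hΩ.exists_isNormalField
  have hfin := hΩ.hausdorffMeasure_frontier_lt_top.ne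
  have := hΩ.isFiniteMeasure_frontier
  have hone : ENNReal.ofReal (∫ _ in frontier Ω, (1 : ℝ) ∂(Measure.hausdorffMeasure 1)) =
      Measure.hausdorffMeasure 1 (frontier Ω) := by
    simp [Measure.real, ENNReal.ofReal_toReal hfin]
  apply le_antisymm
  · refine iSup₂_le fun T hT => ?_
    rw [← hone, hΩ.integral_planeDiv hn hT.1]
    refine ENNReal.ofReal_le_ofReal (integral_mono ?_ (integrable_const _) fun y => ?_)
    · exact hΩ.integrableOn_frontier (hT.1.continuous.inner hn.contDiff.continuous).continuousOn
    · calc _ ≤ ‖T y‖ * ‖n y‖ := real_inner_le_norm _ _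
        _ ≤ 1 := mul_le_one₀ (hT.2.2 y) (norm_nonneg _) (hn.norm_le_one y)
  · rw [← hone]
    refine le_trans (le_of_eq ?_)
      (le_iSup₂ (f := fun (T : Plane → Plane)
        (_ : ContDiff ℝ 1 T ∧ HasCompactSupport T ∧ ∀ x, ‖T x‖ ≤ 1) =>
          ENNReal.ofReal (∫ x in Ω, planeDiv T x)) n
        ⟨hn.contDiff, hn.hasCompactSupport, hn.norm_le_one⟩)
    rw [hΩ.integral_planeDiv hn hn.contDiff]
    congr 1
    refine setIntegral_congr_fun isClosed_frontier.measurableSet fun y hy => ?_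
    simp [hn.norm_eq_one hΩ hy]

end Divergence

/-! ### The radial field generating the kernel. -/

/-- The radial vector field with profile `g(|z|²)`. -/
noncomputable def radialField (g : ℝ → ℝ) (z : Plane) : Plane := g (‖z‖ ^ 2) • z

theorem contDiff_radialField {g : ℝ → ℝ} (hg : ContDiff ℝ 1 g) : ContDiff ℝ 1 (radialField g) :=
  (hg.comp (contDiff_norm_sq ℝ)).smul contDiff_id

theorem fderiv_radialField {g : ℝ → ℝ} (hg : ContDiff ℝ 1 g) (z v : Plane) :
    fderiv ℝ (radialField g) z v =
      g (‖z‖ ^ 2) • v + (deriv g (‖z‖ ^ 2) * (2 * inner ℝ z v)) • z := by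
  have h1 := ((hg.differentiable one_ne_zero (‖z‖ ^ 2)).hasDerivAt).comp_hasFDerivAt z
    (hasStrictFDerivAt_norm_sq z).hasFDerivAt
  have h2 : fderiv ℝ (radialField g) z = _ := (h1.smul (hasFDerivAt_id z)).fderiv
  rw [h2]
  simp

theorem planeDiv_radialField {g : ℝ → ℝ} (hg : ContDiff ℝ 1 g) (z : Plane) :
    planeDiv (radialField g) z = 2 * g (‖z‖ ^ 2) + 2 * ‖z‖ ^ 2 * deriv g (‖z‖ ^ 2) := by
  have hz : ‖z‖ ^ 2 = z 0 ^ 2 + z 1 ^ 2 := by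
    rw [EuclideanSpace.norm_sq_eq, Fin.sum_univ_two, Real.norm_eq_abs, Real.norm_eq_abs, sq_abs, sq_abs]
  simp only [planeDiv, fderiv_radialField hg, Fin.sum_univ_two]
  simp only [inner_plane]
  simp
  generalize deriv g (‖z‖ ^ 2) = d
  rw [hz]
  ring

theorem integrable_of_continuous_of_le_yukawa {E : Type*} [NormedAddCommGroup E] {F : Plane → E}
    (hF : Continuous F) {a : ℝ} (ha : 0 < a) {R C : ℝ}
    (h : ∀ z, R < ‖z‖ → ‖F z‖ ≤ C * yukawa a z) : Integrable F := by
  rw [← integrableOn_univ, ← Set.union_compl_self (Metric.closedBall (0 : Plane) R)]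
  refine (hF.continuousOn.integrableOn_compact (isCompact_closedBall _ _)).union ?_
  refine Integrable.mono' ((integrable_yukawa ha).const_mul C).integrableOn
    hF.aestronglyMeasurable.restrict ?_
  refine (ae_restrict_iff' Metric.isClosed_closedBall.measurableSet.compl).2
    (Eventually.of_forall fun z hz => h z ?_)
  simpa using hz

/-- The profile of the field with divergence `-yukawa a`, cut off near the origin. -/
noncomputable def fluxProfile (a ε u : ℝ) : ℝ :=
  Real.smoothTransition (2 * u / ε ^ 2 - 1) * (Real.exp (-(a * √u)) / (a * u))

theorem fluxProfile_eq {a ε u : ℝ} (hε : 0 < ε) (hu : ε ^ 2 ≤ u) :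
    fluxProfile a ε u = Real.exp (-(a * √u)) / (a * u) := by
  rw [fluxProfile, Real.smoothTransition.one_of_one_le, one_mul]
  have : 1 ≤ u / ε ^ 2 := (one_le_div (by positivity)).2 hu
  rw [mul_div_assoc]
  linarith

/-- The cutoff vanishes for `u ≤ ε²/2`, which removes the singularities of the root and of the
quotient at `0`. -/
theorem contDiff_fluxProfile {a ε : ℝ} (ha : 0 < a) (hε : 0 < ε) : ContDiff ℝ 1 (fluxProfile a ε) := by
  rw [contDiff_iff_contDiffAt]
  intro u
  rcases lt_or_ge u (ε ^ 2 / 2) with hu | hu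
  · have : fluxProfile a ε =ᶠ[𝓝 u] fun _ => 0 := by
      filter_upwards [eventually_lt_nhds hu] with v hv
      rw [fluxProfile, Real.smoothTransition.zero_of_nonpos, zero_mul]
      have : v / ε ^ 2 ≤ 1 / 2 := by rw [div_le_iff₀ (by positivity)]; linarith
      rw [mul_div_assoc]
      linarith
    exact contDiffAt_const.congr_of_eventuallyEq this
  · have hu0 : 0 < u := lt_of_lt_of_le (by positivity) hu
    have h1 : ContDiff ℝ 1 fun u : ℝ => Real.smoothTransition (2 * u / ε ^ 2 - 1) :=
      (Real.smoothTransition.contDiff (n := 1)).comp (by fun_prop)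
    have h2 : ContDiffAt ℝ 1 (fun u : ℝ => Real.exp (-(a * √u))) u :=
      ((contDiffAt_const.mul (Real.contDiffAt_sqrt hu0.ne')).neg).exp
    exact h1.contDiffAt.mul (h2.div (contDiffAt_const.mul contDiffAt_id) (by positivity))

theorem deriv_fluxProfile {a ε u : ℝ} (ha : 0 < a) (hε : 0 < ε) (hu : ε ^ 2 < u) :
    deriv (fluxProfile a ε) u =
      -(Real.exp (-(a * √u)) / (2 * √u * u)) - Real.exp (-(a * √u)) / (a * u ^ 2) := by
  have hu0 : 0 < u := lt_trans (by positivity) hu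
  have heq : fluxProfile a ε =ᶠ[𝓝 u] fun u => Real.exp (-(a * √u)) / (a * u) := by
    filter_upwards [eventually_gt_nhds hu] with v hv using fluxProfile_eq hε hv.le
  rw [heq.deriv_eq]
  have hs : 0 < √u := Real.sqrt_pos.2 hu0
  have h1 := ((Real.hasDerivAt_sqrt hu0.ne').const_mul a).fun_neg.exp
  have h2 := h1.fun_div ((hasDerivAt_id' u).const_mul a) (by positivity)
  rw [h2.deriv]
  field_simp

theorem planeDiv_radialField_fluxProfile {a ε : ℝ} (ha : 0 < a) (hε : 0 < ε) {z : Plane}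
    (hz : ε < ‖z‖) : planeDiv (radialField (fluxProfile a ε)) z = -yukawa a z := by
  have hz0 : 0 < ‖z‖ := hε.trans hz
  have hu : ε ^ 2 < ‖z‖ ^ 2 := by gcongr
  rw [planeDiv_radialField (contDiff_fluxProfile ha hε), deriv_fluxProfile ha hε hu,
    fluxProfile_eq hε hu.le, Real.sqrt_sq hz0.le, yukawa]
  field_simp
  ring

theorem integrable_radialField_fluxProfile {a ε : ℝ} (ha : 0 < a) (hε : 0 < ε) :
    Integrable (radialField (fluxProfile a ε)) := by
  refine integrable_of_continuous_of_le_yukawa (R := ε) (C := 1 / a)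
    (contDiff_radialField (contDiff_fluxProfile ha hε)).continuous ha fun z hz => ?_
  have hz0 : 0 < ‖z‖ := hε.trans hz
  have hu : ε ^ 2 < ‖z‖ ^ 2 := by gcongr
  rw [radialField, norm_smul, fluxProfile_eq hε hu.le, Real.sqrt_sq hz0.le, yukawa,
    Real.norm_of_nonneg (by positivity)]
  apply le_of_eq
  field_simp

theorem integrable_fderiv_radialField_fluxProfile {a ε : ℝ} (ha : 0 < a) (hε : 0 < ε) (v : Plane) :
    Integrable fun z => fderiv ℝ (radialField (fluxProfile a ε)) z v := by
  have hg := contDiff_fluxProfile ha hε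
  refine integrable_of_continuous_of_le_yukawa (R := ε) (C := ‖v‖ * (1 + 3 / (a * ε)))
    (continuous_fderiv_apply_const (contDiff_radialField hg) v) ha fun z hz => ?_
  have hz0 : 0 < ‖z‖ := hε.trans hz
  have hu : ε ^ 2 < ‖z‖ ^ 2 := by gcongr
  rw [fderiv_radialField hg, deriv_fluxProfile ha hε hu, fluxProfile_eq hε hu.le,
    Real.sqrt_sq hz0.le, yukawa]
  set E := Real.exp (-(a * ‖z‖))
  have hE : 0 < E := Real.exp_pos _
  set r := ‖z‖
  have hin : |inner ℝ z v| ≤ r * ‖v‖ := abs_real_inner_le_norm z v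
  have h1 : ‖(E / (a * r ^ 2)) • v‖ = E / (a * r ^ 2) * ‖v‖ := by
    rw [norm_smul, Real.norm_of_nonneg (by positivity)]
  have h2 : ‖((-(E / (2 * r * r ^ 2)) - E / (a * (r ^ 2) ^ 2)) * (2 * inner ℝ z v)) • z‖ ≤
      (E / (2 * r * r ^ 2) + E / (a * (r ^ 2) ^ 2)) * (2 * (r * ‖v‖)) * r := by
    rw [norm_smul, Real.norm_eq_abs, abs_mul, abs_mul, abs_two]
    gcongr
    rw [← neg_add', abs_neg, abs_of_nonneg (by positivity)]
  refine (norm_add_le _ _).trans ((add_le_add h1.le h2).trans ?_)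
  have h3 : E / (a * r ^ 2) * ‖v‖ +
      (E / (2 * r * r ^ 2) + E / (a * (r ^ 2) ^ 2)) * (2 * (r * ‖v‖)) * r =
      ‖v‖ * (1 + 3 / (a * r)) * (E / r) := by
    field_simp
    ring
  rw [h3]
  gcongr

/-- The potential of the complement of a regular set at an interior point, as a boundary flux. -/
theorem IsRegularSet.integral_compl_yukawa {Ω : Set Plane} (hΩ : IsRegularSet Ω) {n : Plane → Plane}
    (hn : IsNormalField Ω n) {a : ℝ} (ha : 0 < a) {x : Plane} (hx : x ∈ Ω) :
    ∫ y in Ωᶜ, yukawa a (x - y) =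
      ∫ y in frontier Ω, fluxKernel a (n y) (x - y) ∂(Measure.hausdorffMeasure 1) := by
  -- With the closed `ε`-ball around `x` inside `Ω`, the cutoff alters the field only inside `Ω`:
  -- its values on `∂Ω` and its divergence on `Ωᶜ` are the exact ones.
  obtain ⟨ε, hε, hball⟩ := Metric.nhds_basis_closedBall.mem_iff.1 (hΩ.isOpen.mem_nhds hx)
  have hfar : ∀ y ∉ Ω, ε < ‖y - x‖ := by
    intro y hy
    by_contra hle
    exact hy (hball (by rw [Metric.mem_closedBall, dist_eq_norm]; exact not_lt.1 hle))
  set R := radialField (fluxProfile a ε)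
  have hR : ContDiff ℝ 1 R := contDiff_radialField (contDiff_fluxProfile ha hε)
  set T : Plane → Plane := fun y => R (y - x)
  have hT : ContDiff ℝ 1 T := hR.comp (contDiff_id.sub contDiff_const)
  have hTd : ∀ y, fderiv ℝ T y = fderiv ℝ R (y - x) := fun y => fderiv_comp_sub x
  have hTdiv : ∀ y, planeDiv T y = planeDiv R (y - x) := fun y => by simp only [planeDiv, hTd]
  have hTi : Integrable T := (integrable_radialField_fluxProfile ha hε).comp_sub_right x
  have hTdi : ∀ v, Integrable fun y => fderiv ℝ T y v := fun v => by
    simp only [hTd]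
    exact (integrable_fderiv_radialField_fluxProfile ha hε v).comp_sub_right x
  have hdivi : Integrable (planeDiv T) := by
    unfold planeDiv
    exact integrable_finsetSum _ fun i _ =>
      (EuclideanSpace.proj (𝕜 := ℝ) i : Plane →L[ℝ] ℝ).integrable_comp (hTdi _)
  have h0 := integral_planeDiv_eq_zero (hT.differentiable one_ne_zero) hTi hTdi
  rw [← integral_add_compl hΩ.isOpen.measurableSet hdivi, hΩ.integral_planeDiv hn hT] at h0
  have h1 : ∫ y in Ωᶜ, planeDiv T y = -∫ y in Ωᶜ, yukawa a (x - y) := by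
    rw [← integral_neg]
    refine setIntegral_congr_fun hΩ.isOpen.measurableSet.compl fun y hy => ?_
    simp only [hTdiv, R]
    rw [planeDiv_radialField_fluxProfile ha hε (hfar y hy), ← yukawa_neg, neg_sub]
  have h2 : ∫ y in frontier Ω, inner ℝ (T y) (n y) ∂(Measure.hausdorffMeasure 1) =
      ∫ y in frontier Ω, fluxKernel a (n y) (x - y) ∂(Measure.hausdorffMeasure 1) := by
    refine setIntegral_congr_fun isClosed_frontier.measurableSet fun y hy => ?_
    rw [hΩ.isOpen.frontier_eq] at hy
    have hz := hfar y hy.2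
    have hz0 : 0 < ‖y - x‖ := hε.trans hz
    have hu : ε ^ 2 < ‖y - x‖ ^ 2 := by gcongr
    simp only [T, R, radialField, fluxKernel]
    rw [fluxProfile_eq hε hu.le, Real.sqrt_sq hz0.le, norm_sub_rev x y, real_inner_smul_left,
      ← inner_neg_right, neg_sub, real_inner_comm]
    field_simp
  rw [h1, h2] at h0
  linarith

/-! ### The flux defect under parabolic rescaling. -/

theorem integral_comp_div_div (F : ℝ × ℝ → ℝ) {a b : ℝ} (ha : 0 < a) (hb : 0 < b) :
    ∫ p : ℝ × ℝ, F (p.1 / a, p.2 / b) = a * b * ∫ q, F q := by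
  have hmap : Measure.map (Prod.map (a⁻¹ * ·) (b⁻¹ * ·)) (volume : Measure (ℝ × ℝ)) =
      ENNReal.ofReal (a * b) • volume := by
    rw [Measure.volume_eq_prod, ← Measure.map_prod_map _ _ (measurable_const_mul _)
      (measurable_const_mul _), Real.map_volume_mul_left (inv_ne_zero ha.ne'),
      Real.map_volume_mul_left (inv_ne_zero hb.ne'), Measure.prod_smul_left, Measure.prod_smul_right,
      smul_smul, inv_inv, inv_inv, abs_of_pos ha, abs_of_pos hb, ENNReal.ofReal_mul ha.le]
  have hemb : MeasurableEmbedding (Prod.map (a⁻¹ * ·) (b⁻¹ * ·) : ℝ × ℝ → ℝ × ℝ) :=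
    ((Homeomorph.mulLeft₀ a⁻¹ (inv_ne_zero ha.ne')).prodCongr
      (Homeomorph.mulLeft₀ b⁻¹ (inv_ne_zero hb.ne'))).measurableEmbedding
  have h := hemb.integral_map (μ := volume) F
  rw [hmap, integral_smul_measure, ENNReal.toReal_ofReal (by positivity), smul_eq_mul] at h
  rw [h]
  simp only [Prod.map, div_eq_inv_mul]

/-- The difference between the flux of a half plane and that of `Ω` at the boundary point `y`. -/
noncomputable def fluxDefect (Ω : Set Plane) (a : ℝ) (n y : Plane) : ℝ :=
  2 / a ^ 2 - ∫ x in Ω, fluxKernel a n (x - y)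

/-- The integrand of the flux defect after parabolic rescaling around `y`. -/
noncomputable def scaledDefect (Ω : Set Plane) (y : Plane) (e : Plane ≃ₗᵢ[ℝ] Plane) (a : ℝ)
    (p : ℝ × ℝ) : ℝ :=
  (Set.indicator (Set.Iio 0) 1 p.2 -
      Set.indicator Ω 1 (y + planeCoord e (p.1 / a, p.2 / a ^ 2))) *
    (-p.2 / (p.1 ^ 2 + p.2 ^ 2 / a ^ 2) * Real.exp (-√(p.1 ^ 2 + p.2 ^ 2 / a ^ 2)))

section

variable {Ω : Set Plane} {y n : Plane} {e : Plane ≃ₗᵢ[ℝ] Plane}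

theorem norm_planeCoord_parabolic (e : Plane ≃ₗᵢ[ℝ] Plane) {a : ℝ} (ha : 0 < a) (p : ℝ × ℝ) :
    ‖planeCoord e (p.1 / a, p.2 / a ^ 2)‖ = √(p.1 ^ 2 + p.2 ^ 2 / a ^ 2) / a := by
  have h : (p.1 / a) ^ 2 + (p.2 / a ^ 2) ^ 2 = (p.1 ^ 2 + p.2 ^ 2 / a ^ 2) / a ^ 2 := by
    field_simp
  rw [norm_planeCoord, h, Real.sqrt_div' _ (sq_nonneg a), Real.sqrt_sq ha.le]

/-- The power splits as `a³ · a`: the Jacobian of `(u/a, v/a²)` absorbs `a³`, and the kernel at the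
rescaled point carries a factor `1/a`. -/
theorem pow_four_mul_fluxDefect (hΩ : IsOpen Ω) (hn : ‖n‖ = 1) (he : ∀ z, (e z) 1 = inner ℝ n z)
    {a : ℝ} (ha : 0 < a) :
    a ^ 4 * fluxDefect Ω a n y = ∫ p, scaledDefect Ω y e a p := by
  have hk := integrable_fluxKernel ha n hn.le
  have hm : MeasurableSet {z : Plane | inner ℝ n z < 0} :=
    measurableSet_lt (by fun_prop) measurable_const
  have hm' : MeasurableSet {z : Plane | y + z ∈ Ω} := hΩ.measurableSet.preimage (measurable_const_add y)
  have h1 : ∫ x in Ω, fluxKernel a n (x - y) = ∫ z in {z | y + z ∈ Ω}, fluxKernel a n z := by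
    rw [← integral_indicator hΩ.measurableSet, ← integral_indicator hm',
      ← integral_add_left_eq_self _ y]
    refine integral_congr_ae (Eventually.of_forall fun z => ?_)
    classical
    simp [Set.indicator_apply]
  have h2 : fluxDefect Ω a n y = ∫ z, (Set.indicator {z | inner ℝ n z < 0} 1 z -
      Set.indicator {z | y + z ∈ Ω} 1 z) * fluxKernel a n z := by
    rw [fluxDefect, h1, ← integral_halfPlane_fluxKernel ha n hn, ← integral_indicator hm,
      ← integral_indicator hm', ← integral_sub (hk.indicator hm) (hk.indicator hm')]
    refine integral_congr_ae (Eventually.of_forall fun z => ?_)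
    classical
    simp only [Set.indicator_apply, Pi.one_apply, sub_mul, ite_mul, one_mul, zero_mul]
  rw [h2, ← (measurePreserving_planeCoord e).integral_comp (measurableEmbedding_planeCoord e)]
  have h3 := integral_comp_div_div (fun q => (Set.indicator {z | inner ℝ n z < 0} 1 (planeCoord e q) -
      Set.indicator {z | y + z ∈ Ω} 1 (planeCoord e q)) * fluxKernel a n (planeCoord e q)) ha
      (b := a ^ 2) (by positivity)
  have h4 : ∀ p : ℝ × ℝ, a * ((Set.indicator {z | inner ℝ n z < 0} 1
      (planeCoord e (p.1 / a, p.2 / a ^ 2)) - Set.indicator {z | y + z ∈ Ω} 1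
      (planeCoord e (p.1 / a, p.2 / a ^ 2))) * fluxKernel a n (planeCoord e (p.1 / a, p.2 / a ^ 2))) =
      scaledDefect Ω y e a p := by
    intro p
    classical
    have hin : inner ℝ n (planeCoord e (p.1 / a, p.2 / a ^ 2)) = p.2 / a ^ 2 := by
      rw [← he, apply_planeCoord_one]
    have hneg : p.2 / a ^ 2 < 0 ↔ p.2 < 0 := by
      rw [div_lt_iff₀ (by positivity), zero_mul]
    have hpos : 0 ≤ p.1 ^ 2 + p.2 ^ 2 / a ^ 2 := by positivity
    simp only [Set.indicator_apply, scaledDefect, Set.mem_ofPred_eq, hin, hneg, Set.mem_Iio]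
    rw [fluxKernel, hin, norm_planeCoord_parabolic e ha, div_pow, Real.sq_sqrt hpos,
      mul_div_cancel₀ _ ha.ne', mul_left_comm]
    congr 1
    -- When the denominator vanishes both kernels are `0`, by the convention on division by zero.
    rcases eq_or_ne (p.1 ^ 2 + p.2 ^ 2 / a ^ 2) 0 with h0 | h0
    · simp [h0]
    · generalize p.1 ^ 2 + p.2 ^ 2 / a ^ 2 = m at *
      field_simp
  rw [← integral_congr_ae (Eventually.of_forall h4), integral_const_mul, h3]
  ring

theorem measurable_scaledDefect (hΩ : IsOpen Ω) (y : Plane) (e : Plane ≃ₗᵢ[ℝ] Plane) (a : ℝ) :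
    Measurable (scaledDefect Ω y e a) := by
  unfold scaledDefect
  have h1 : Measurable fun p : ℝ × ℝ => Set.indicator (Set.Iio 0) (1 : ℝ → ℝ) p.2 :=
    (measurable_one.indicator measurableSet_Iio).comp measurable_snd
  have h2 : Measurable fun p : ℝ × ℝ => y + planeCoord e (p.1 / a, p.2 / a ^ 2) :=
    measurable_const.add ((planeCoord e).continuous.measurable.comp (by fun_prop))
  have h3 : Measurable fun p : ℝ × ℝ =>
      Set.indicator Ω (1 : Plane → ℝ) (y + planeCoord e (p.1 / a, p.2 / a ^ 2)) :=
    (measurable_one.indicator hΩ.measurableSet).comp h2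
  exact (h1.sub h3).mul (by fun_prop)

/-- The exponential series gives `m² ≤ 2eᵐ`, `m⁴ ≤ 24eᵐ` and `m⁶ ≤ 720eᵐ`; the constants are `3 = 1
+ 2` and `744 = 24 + 720`. -/
theorem one_add_sq_mul_le_exp {C m u v : ℝ} (hm : 0 ≤ m) (hu : u ^ 2 ≤ m ^ 2)
    (hv : |v| ≤ C * m ^ 2) :
    (1 + u ^ 2) * (1 + v ^ 2) ≤ (3 + 744 * C ^ 2) * Real.exp m := by
  have h2 := Real.pow_div_factorial_le_exp m hm 2
  have h4 := Real.pow_div_factorial_le_exp m hm 4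
  have h6 := Real.pow_div_factorial_le_exp m hm 6
  have h0 := Real.one_le_exp hm
  norm_num [Nat.factorial] at h2 h4 h6
  have hv2 : v ^ 2 ≤ (C * m ^ 2) ^ 2 := by
    rw [← sq_abs v]; gcongr
  calc (1 + u ^ 2) * (1 + v ^ 2) ≤ (1 + m ^ 2) * (1 + (C * m ^ 2) ^ 2) := by gcongr
    _ = 1 + m ^ 2 + C ^ 2 * m ^ 4 + C ^ 2 * m ^ 6 := by ring
    _ ≤ Real.exp m + 2 * Real.exp m + C ^ 2 * (24 * Real.exp m) + C ^ 2 * (720 * Real.exp m) := by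
        gcongr <;> linarith
    _ = _ := by ring

/-- With `M = u² + v²/a²`, the indicators agree unless `|v| ≤ C M`. There the quotient in the kernel
is at most `C`, and `e^{-√M}` yields a product bound independent of `a`. -/
theorem abs_scaledDefect_le (he : ∀ z, (e z) 1 = inner ℝ n z) {C : ℝ} (hC : 0 ≤ C)
    (ht : IsParabolicTangent Ω y n C) {a : ℝ} (ha : 0 < a) (p : ℝ × ℝ) :
    |scaledDefect Ω y e a p| ≤
      C * (3 + 744 * C ^ 2) * ((1 + p.1 ^ 2)⁻¹ * (1 + p.2 ^ 2)⁻¹) := by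
  classical
  have hin : inner ℝ n (planeCoord e (p.1 / a, p.2 / a ^ 2)) = p.2 / a ^ 2 := by
    rw [← he, apply_planeCoord_one]
  have hpos : 0 ≤ p.1 ^ 2 + p.2 ^ 2 / a ^ 2 := by positivity
  have hnorm : ‖planeCoord e (p.1 / a, p.2 / a ^ 2)‖ ^ 2 = (p.1 ^ 2 + p.2 ^ 2 / a ^ 2) / a ^ 2 := by
    rw [norm_planeCoord_parabolic e ha, div_pow, Real.sq_sqrt hpos]
  obtain ⟨h1, h2⟩ := ht (planeCoord e (p.1 / a, p.2 / a ^ 2))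
  rw [hin, hnorm, ← mul_div_assoc, ← neg_div, div_lt_div_iff_of_pos_right (by positivity)] at h1
  rw [hin, hnorm, ← mul_div_assoc, div_lt_div_iff_of_pos_right (by positivity)] at h2
  have hbd : 0 ≤ C * (3 + 744 * C ^ 2) * ((1 + p.1 ^ 2)⁻¹ * (1 + p.2 ^ 2)⁻¹) := by positivity
  set M := p.1 ^ 2 + p.2 ^ 2 / a ^ 2
  have hCM : 0 ≤ C * M := by positivity
  rcases lt_or_ge p.2 (-(C * M)) with hlt | hge
  · have : scaledDefect Ω y e a p = 0 := by
      rw [scaledDefect, Set.indicator_of_mem (h1 hlt),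
        Set.indicator_of_mem (show p.2 ∈ Set.Iio 0 from lt_of_lt_of_le hlt (by linarith))]
      simp
    rwa [this, abs_zero]
  rcases lt_or_ge (C * M) p.2 with hgt | hle
  · have : scaledDefect Ω y e a p = 0 := by
      rw [scaledDefect, Set.indicator_of_notMem (h2 hgt),
        Set.indicator_of_notMem (show p.2 ∉ Set.Iio 0 from not_lt.2 (hCM.trans hgt.le))]
      simp
    rwa [this, abs_zero]
  have hv : |p.2| ≤ C * M := abs_le.2 ⟨hge, hle⟩
  have hM : √M ^ 2 = M := Real.sq_sqrt hpos
  have hexp := one_add_sq_mul_le_exp (C := C) (u := p.1) (v := p.2) (Real.sqrt_nonneg M)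
    (by rw [hM]; simp only [M]; linarith [show 0 ≤ p.2 ^ 2 / a ^ 2 by positivity]) (by rwa [hM])
  have hfac : |Set.indicator (Set.Iio 0) (1 : ℝ → ℝ) p.2 -
      Set.indicator Ω (1 : Plane → ℝ) (y + planeCoord e (p.1 / a, p.2 / a ^ 2))| ≤ 1 := by
    simp only [Set.indicator_apply, Pi.one_apply]
    split_ifs <;> simp
  have hker : |-p.2 / M| ≤ C := by
    rw [abs_div, abs_neg, abs_of_nonneg hpos]
    exact div_le_of_le_mul₀ hpos hC hv
  rw [scaledDefect, abs_mul, abs_mul, Real.abs_exp]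
  calc _ ≤ 1 * (C * Real.exp (-√M)) := by gcongr
    _ = C * Real.exp (-√M) := one_mul _
    _ ≤ C * ((3 + 744 * C ^ 2) * ((1 + p.1 ^ 2)⁻¹ * (1 + p.2 ^ 2)⁻¹)) := by
        gcongr
        rw [← mul_inv, Real.exp_neg, ← div_eq_mul_inv, le_div_iff₀ (by positivity),
          inv_mul_eq_div, div_le_iff₀ (Real.exp_pos _)]
        exact hexp
    _ = _ := by ring

theorem integrable_inv_one_add_sq_prod :
    Integrable fun p : ℝ × ℝ => (1 + p.1 ^ 2)⁻¹ * (1 + p.2 ^ 2)⁻¹ :=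
  integrable_inv_one_add_sq.mul_prod integrable_inv_one_add_sq

theorem abs_pow_four_mul_fluxDefect_le (hΩ : IsOpen Ω) (hn : ‖n‖ = 1) {C : ℝ} (hC : 0 ≤ C)
    (ht : IsParabolicTangent Ω y n C) {a : ℝ} (ha : 0 < a) :
    |a ^ 4 * fluxDefect Ω a n y| ≤
      ∫ p : ℝ × ℝ, C * (3 + 744 * C ^ 2) * ((1 + p.1 ^ 2)⁻¹ * (1 + p.2 ^ 2)⁻¹) := by
  obtain ⟨e, he⟩ := exists_isometry_apply_one_eq_inner n hn
  rw [pow_four_mul_fluxDefect hΩ hn he ha, ← Real.norm_eq_abs]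
  exact norm_integral_le_of_norm_le (integrable_inv_one_add_sq_prod.const_mul _)
    (Eventually.of_forall fun p => abs_scaledDefect_le he hC ht ha p)

/-! ### The limiting defect and its value. -/

/-- The limit of the rescaled defect integrand at a boundary point of curvature `c`. -/
noncomputable def limitDefect (c : ℝ) (p : ℝ × ℝ) : ℝ :=
  (Set.indicator (Set.Iio 0) 1 p.2 - Set.indicator (Set.Iio (c / 2 * p.1 ^ 2)) 1 p.2) *
    (-p.2 / p.1 ^ 2 * Real.exp (-|p.1|))

theorem measurable_limitDefect (c : ℝ) : Measurable (limitDefect c) := by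
  unfold limitDefect
  have h1 : Measurable fun p : ℝ × ℝ => Set.indicator (Set.Iio 0) (1 : ℝ → ℝ) p.2 :=
    (measurable_one.indicator measurableSet_Iio).comp measurable_snd
  have h2 : Measurable fun p : ℝ × ℝ => Set.indicator (Set.Iio (c / 2 * p.1 ^ 2)) (1 : ℝ → ℝ) p.2 := by
    have : MeasurableSet {p : ℝ × ℝ | p.2 < c / 2 * p.1 ^ 2} :=
      measurableSet_lt measurable_snd (by fun_prop)
    exact (measurable_one (α := ℝ) (β := ℝ × ℝ)).indicator this
  exact (h1.sub h2).mul (by fun_prop)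

/-- For either sign of `w` this is the oriented integral of `v` from `0` to `w`: the difference of
indicators supplies the sign. -/
theorem integral_indicator_Iio_sub (w : ℝ) :
    ∫ v : ℝ, (Set.indicator (Set.Iio 0) 1 v - Set.indicator (Set.Iio w) 1 v) * -v = w ^ 2 / 2 := by
  classical
  have h : ∫ v in (0 : ℝ)..w, v = w ^ 2 / 2 := by simp [integral_id]
  rw [← h]
  rcases le_total 0 w with hw | hw
  · rw [intervalIntegral.integral_of_le hw, integral_Ioc_eq_integral_Ioo, ← integral_Ico_eq_integral_Ioo,
      ← integral_indicator measurableSet_Ico]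
    refine integral_congr_ae (Eventually.of_forall fun v => ?_)
    simp only [Set.indicator_apply, Set.mem_Iio, Set.mem_Ico, Pi.one_apply]
    split_ifs <;> grind
  · rw [intervalIntegral.integral_of_ge hw, integral_Ioc_eq_integral_Ioo, ← integral_Ico_eq_integral_Ioo,
      ← integral_indicator measurableSet_Ico, ← integral_neg]
    refine integral_congr_ae (Eventually.of_forall fun v => ?_)
    simp only [Set.indicator_apply, Set.mem_Iio, Set.mem_Ico, Pi.one_apply]
    split_ifs <;> grind

theorem integral_sq_mul_exp_neg_abs : ∫ u : ℝ, u ^ 2 * Real.exp (-|u|) = 4 := by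
  have h1 : ∫ u : ℝ, u ^ 2 * Real.exp (-|u|) = ∫ u : ℝ, |u| ^ 2 * Real.exp (-|u|) := by simp
  rw [h1, integral_comp_abs (f := fun u => u ^ 2 * Real.exp (-u))]
  have h2 := Real.Gamma_eq_integral (s := 3) (by norm_num)
  have h3 : Real.Gamma 3 = 2 := by
    rw [show (3 : ℝ) = (2 : ℕ) + 1 by norm_num, Real.Gamma_nat_eq_factorial]
    norm_num
  have h4 : ∫ u in Set.Ioi (0 : ℝ), u ^ 2 * Real.exp (-u) = 2 := by
    rw [← h3, h2]
    refine setIntegral_congr_fun measurableSet_Ioi fun u _ => ?_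
    rw [show (3 : ℝ) - 1 = (2 : ℕ) by norm_num]
    simp only [Real.rpow_natCast]
    ring
  rw [h4]
  norm_num

theorem integral_limitDefect {c : ℝ} (hc : Integrable (limitDefect c)) :
    ∫ p, limitDefect c p = c ^ 2 / 2 := by
  rw [Measure.volume_eq_prod, integral_prod _ hc]
  have h : ∀ u : ℝ, ∫ v, limitDefect c (u, v) = c ^ 2 / 8 * (u ^ 2 * Real.exp (-|u|)) := by
    intro u
    have h1 : ∀ v, limitDefect c (u, v) =
        ((Set.indicator (Set.Iio 0) 1 v - Set.indicator (Set.Iio (c / 2 * u ^ 2)) 1 v) * -v) *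
          (Real.exp (-|u|) / u ^ 2) := by
      intro v
      simp only [limitDefect]
      ring
    simp_rw [h1]
    rw [integral_mul_const, integral_indicator_Iio_sub]
    rcases eq_or_ne u 0 with rfl | hu
    · simp
    · field_simp
      ring
  simp_rw [h]
  rw [integral_const_mul, integral_sq_mul_exp_neg_abs]
  ring

theorem tendsto_scaledDefect {U : Set Plane} {e' : Plane ≃ₗᵢ[ℝ] Plane} {f : ℝ → ℝ}
    (h : IsGraphChart Ω U e' f) (hΩ : IsOpen Ω) (hy : y ∈ U) (hyΩ : y ∈ frontier Ω)
    (he : ∀ z, (e z) 1 = inner ℝ (chartNormal e' f y) z) {p : ℝ × ℝ} (hp1 : p.1 ≠ 0)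
    (hp2 : p.2 ≠ graphCurvature f ((e' y) 0) / 2 * p.1 ^ 2) :
    Tendsto (fun a => scaledDefect Ω y e a p) atTop
      (𝓝 (limitDefect (graphCurvature f ((e' y) 0)) p)) := by
  classical
  unfold scaledDefect limitDefect
  have hM : Tendsto (fun a : ℝ => p.1 ^ 2 + p.2 ^ 2 / a ^ 2) atTop (𝓝 (p.1 ^ 2)) := by
    have h1 : Tendsto (fun a : ℝ => p.1 ^ 2 + p.2 ^ 2 * (a⁻¹) ^ 2) atTop
        (𝓝 (p.1 ^ 2 + p.2 ^ 2 * 0 ^ 2)) :=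
      ((tendsto_inv_atTop_zero.pow 2).const_mul _).const_add _
    simpa [div_eq_mul_inv] using h1
  refine Tendsto.mul ?_ ?_
  · refine Tendsto.congr' ?_ tendsto_const_nhds
    filter_upwards [h.eventually_mem_parabolic_scaling hΩ hy hyΩ he hp2] with a ha
    simp only [Set.indicator_apply, ha, Set.mem_Iio]
    rfl
  · refine Tendsto.mul (tendsto_const_nhds.div hM (pow_ne_zero 2 hp1)) ?_
    have := hM.sqrt
    rw [Real.sqrt_sq_eq_abs] at this
    exact (Real.continuous_exp.tendsto _).comp this.neg

theorem tendsto_pow_four_mul_fluxDefect {U : Set Plane} {e' : Plane ≃ₗᵢ[ℝ] Plane} {f : ℝ → ℝ}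
    (h : IsGraphChart Ω U e' f) (hΩ : IsOpen Ω) (hy : y ∈ U) (hyΩ : y ∈ frontier Ω) :
    Tendsto (fun a => a ^ 4 * fluxDefect Ω a (chartNormal e' f y) y) atTop
      (𝓝 (curvature Ω y ^ 2 / 2)) := by
  have hn := norm_chartNormal e' f y
  obtain ⟨e, he⟩ := exists_isometry_apply_one_eq_inner _ hn
  obtain ⟨C, hC⟩ := h.exists_isParabolicTangent hΩ hy
  have hC := (hC.self_of_nhds hyΩ).mono (le_abs_self C)
  rw [h.curvature_sq hΩ hy hyΩ]
  set c := graphCurvature f ((e' y) 0)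
  have hae : ∀ᵐ p : ℝ × ℝ, p.1 ≠ 0 ∧ p.2 ≠ c / 2 * p.1 ^ 2 := by
    have hm : MeasurableSet {p : ℝ × ℝ | p.1 ≠ 0 ∧ p.2 ≠ c / 2 * p.1 ^ 2} :=
      (measurableSet_eq_fun measurable_fst measurable_const).compl.inter
        (measurableSet_eq_fun measurable_snd (by fun_prop)).compl
    rw [Measure.volume_eq_prod]
    refine (Measure.ae_prod_mem_iff_ae_ae_mem hm).2 ?_
    filter_upwards [Measure.ae_ne volume (0 : ℝ)] with u hu
    filter_upwards [Measure.ae_ne volume (c / 2 * u ^ 2)] with v hv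
    exact ⟨hu, hv⟩
  have hlim : ∀ᵐ p : ℝ × ℝ, Tendsto (fun a => scaledDefect Ω y e a p) atTop (𝓝 (limitDefect c p)) := by
    filter_upwards [hae] with p hp using tendsto_scaledDefect h hΩ hy hyΩ he hp.1 hp.2
  have hdom := integrable_inv_one_add_sq_prod.const_mul (|C| * (3 + 744 * |C| ^ 2))
  have hbd : ∀ᶠ a : ℝ in atTop, ∀ p, |scaledDefect Ω y e a p| ≤
      |C| * (3 + 744 * |C| ^ 2) * ((1 + p.1 ^ 2)⁻¹ * (1 + p.2 ^ 2)⁻¹) := by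
    filter_upwards [eventually_gt_atTop 0] with a ha p
    exact abs_scaledDefect_le he (abs_nonneg C) hC ha p
  -- The limit inherits the dominating function, so its integrability needs no separate estimate.
  have hlint : Integrable (limitDefect c) := by
    refine hdom.mono' (measurable_limitDefect c).aestronglyMeasurable ?_
    filter_upwards [hlim] with p hp
    exact le_of_tendsto hp.norm (hbd.mono fun a ha => ha p)
  have := tendsto_integral_filter_of_dominated_convergence _
    (Eventually.of_forall fun a => (measurable_scaledDefect hΩ y e a).aestronglyMeasurable)
    (hbd.mono fun a ha => Eventually.of_forall ha) hdom hlim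
  rw [integral_limitDefect hlint] at this
  refine this.congr' ?_
  filter_upwards [eventually_gt_atTop 0] with a ha
  exact (pow_four_mul_fluxDefect hΩ hn he ha).symm

end

/-! ### Uniformity along the boundary and integrability. -/

theorem IsRegularSet.exists_uniform_isParabolicTangent {Ω : Set Plane} (hΩ : IsRegularSet Ω)
    {n : Plane → Plane} (hn : IsNormalField Ω n) :
    ∃ C : ℝ, 0 ≤ C ∧ ∀ y ∈ frontier Ω, IsParabolicTangent Ω y (n y) C := by
  suffices ∃ C : ℝ, ∀ y ∈ frontier Ω, y ∈ frontier Ω → IsParabolicTangent Ω y (n y) C by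
    obtain ⟨C, hC⟩ := this
    exact ⟨|C|, abs_nonneg C, fun y hy => (hC y hy hy).mono (le_abs_self C)⟩
  refine hΩ.isCompact_frontier.induction_on
    (p := fun s => ∃ C : ℝ, ∀ y ∈ s, y ∈ frontier Ω → IsParabolicTangent Ω y (n y) C) ?_ ?_ ?_ ?_
  · exact ⟨0, by simp⟩
  · rintro s t hst ⟨C, hC⟩
    exact ⟨C, fun y hy => hC y (hst hy)⟩
  · rintro s t ⟨C, hC⟩ ⟨D, hD⟩
    refine ⟨max C D, ?_⟩
    rintro y (hy | hy) hyΩ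
    · exact (hC y hy hyΩ).mono (le_max_left _ _)
    · exact (hD y hy hyΩ).mono (le_max_right _ _)
  · intro x hx
    obtain ⟨r, e, f, hr, h⟩ := hΩ.exists_isGraphChart hx
    obtain ⟨C, hC⟩ := h.exists_isParabolicTangent hΩ.isOpen (Metric.mem_ball_self hr)
    refine ⟨_, mem_nhdsWithin_of_mem_nhds (inter_mem hC (Metric.ball_mem_nhds x hr)), C, ?_⟩
    rintro y ⟨hy, hyU⟩ hyΩ
    rw [hn.eq_chartNormal y hyΩ _ e f h hyU]
    exact hy hyΩ

theorem continuous_graphCurvature {f : ℝ → ℝ} (hf : ContDiff ℝ ∞ f) :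
    Continuous (graphCurvature f) := by
  have h2 : Continuous (deriv (deriv f)) := (hf.iterate_deriv 2).continuous
  exact h2.div ((contDiff_graphSpeed hf).continuous.pow 3)
    fun s => pow_ne_zero 3 (graphSpeed_pos f s).ne'

theorem IsRegularSet.continuousOn_curvature_sq {Ω : Set Plane} (hΩ : IsRegularSet Ω) :
    ContinuousOn (fun x => curvature Ω x ^ 2) (frontier Ω) := by
  intro x hx
  obtain ⟨r, e, f, hr, h⟩ := hΩ.exists_isGraphChart hx
  have hc : Continuous fun y => graphCurvature f ((e y) 0) ^ 2 :=
    ((continuous_graphCurvature h.contDiff).comp (contDiff_coord e 0 (n := 0)).continuous).pow 2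
  refine hc.continuousWithinAt.congr_of_eventuallyEq ?_
    (h.curvature_sq hΩ.isOpen (Metric.mem_ball_self hr) hx)
  filter_upwards [mem_nhdsWithin_of_mem_nhds (Metric.ball_mem_nhds x hr), self_mem_nhdsWithin]
    with y hyU hy
  exact h.curvature_sq hΩ.isOpen hyU hy

theorem IsRegularSet.integrableOn_curvature_sq {Ω : Set Plane} (hΩ : IsRegularSet Ω) :
    IntegrableOn (fun x => curvature Ω x ^ 2) (frontier Ω) (Measure.hausdorffMeasure 1) :=
  hΩ.integrableOn_frontier hΩ.continuousOn_curvature_sq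

/-- The integrand is, up to order of variables, that of the convolution of the indicator of `Ω` with
an integrable kernel, restricted to `Ω × Ωᶜ`. -/
theorem IsRegularSet.integrable_yukawa_prod {Ω : Set Plane} (hΩ : IsRegularSet Ω) {a : ℝ}
    (ha : 0 < a) : Integrable (fun p : Plane × Plane => yukawa a (p.1 - p.2))
      ((volume.restrict Ω).prod (volume.restrict Ωᶜ)) := by
  have hfin : volume Ω ≠ ⊤ := hΩ.isBounded.measure_lt_top.ne
  have hind : Integrable (Set.indicator Ω (1 : Plane → ℝ)) :=
    (integrable_indicator_iff hΩ.isOpen.measurableSet).2 (integrableOn_const hfin)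
  have h1 := (hind.convolution_integrand (ContinuousLinearMap.mul ℝ ℝ) (integrable_yukawa ha)).swap
  have h2 := h1.integrableOn (s := Ω ×ˢ Ωᶜ)
  rw [IntegrableOn, ← Measure.prod_restrict] at h2
  refine h2.congr ?_
  rw [Measure.prod_restrict]
  refine (ae_restrict_iff' (hΩ.isOpen.measurableSet.prod hΩ.isOpen.measurableSet.compl)).2
    (Eventually.of_forall fun p hp => ?_)
  simp only [Function.comp_apply, Prod.swap, ContinuousLinearMap.mul_apply']
  rw [Set.indicator_of_mem hp.1, Pi.one_apply, one_mul, ← yukawa_neg, neg_sub]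

/-! ### Expansion of the energy. -/

section Energy

variable {Ω : Set Plane} {n : Plane → Plane} {a : ℝ}

theorem IsNormalField.measurable_fluxKernel_sub (hn : IsNormalField Ω n) (a : ℝ) :
    Measurable fun p : Plane × Plane => fluxKernel a (n p.2) (p.1 - p.2) := by
  have h1 : Measurable fun p : Plane × Plane => n p.2 :=
    hn.contDiff.continuous.measurable.comp measurable_snd
  have h2 : Measurable fun p : Plane × Plane => p.1 - p.2 := measurable_fst.sub measurable_snd
  have h3 : Measurable fun p : Plane × Plane => inner ℝ (n p.2) (p.1 - p.2) := h1.inner h2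
  exact ((h3.neg.div (h2.norm.pow_const 2)).mul (h2.norm.const_mul a).neg.exp).div_const a

/-- Every slice in `x` has norm at most `∫ yukawa a / a`, uniformly in `y`, and the boundary has
finite length. -/
theorem IsRegularSet.integrable_fluxKernel_prod (hΩ : IsRegularSet Ω) (hn : IsNormalField Ω n)
    (ha : 0 < a) : Integrable (fun p : Plane × Plane => fluxKernel a (n p.2) (p.1 - p.2))
      ((volume.restrict Ω).prod ((Measure.hausdorffMeasure 1).restrict (frontier Ω))) := by
  have := hΩ.isFiniteMeasure_frontier
  have hmeas := (hn.measurable_fluxKernel_sub a).aestronglyMeasurable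
    (μ := (volume.restrict Ω).prod ((Measure.hausdorffMeasure 1).restrict (frontier Ω)))
  have hslice : ∀ y, Integrable fun x => fluxKernel a (n y) (x - y) := fun y =>
    (integrable_fluxKernel ha (n y) (hn.norm_le_one y)).comp_sub_right y
  refine (integrable_prod_iff' hmeas).2 ⟨Eventually.of_forall fun y => (hslice y).integrableOn, ?_⟩
  refine Integrable.of_bound hmeas.norm.prod_swap.integral_prod_right' (∫ z, yukawa a z / a)
    (Eventually.of_forall fun y => ?_)
  rw [Real.norm_of_nonneg (by positivity)]
  calc ∫ x in Ω, ‖fluxKernel a (n y) (x - y)‖ ≤ ∫ x, ‖fluxKernel a (n y) (x - y)‖ :=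
        setIntegral_le_integral (hslice y).norm (Eventually.of_forall fun x => norm_nonneg _)
    _ = ∫ z, ‖fluxKernel a (n y) z‖ :=
        integral_sub_right_eq_self (fun z => ‖fluxKernel a (n y) z‖) y
    _ ≤ ∫ z, yukawa a z / a :=
        integral_mono (integrable_fluxKernel ha (n y) (hn.norm_le_one y)).norm
          ((integrable_yukawa ha).div_const a) fun z => abs_fluxKernel_le ha (n y) z (hn.norm_le_one y)

theorem IsRegularSet.integrable_fluxDefect (hΩ : IsRegularSet Ω) (hn : IsNormalField Ω n)
    (ha : 0 < a) :
    IntegrableOn (fun y => fluxDefect Ω a (n y) y) (frontier Ω) (Measure.hausdorffMeasure 1) := by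
  have := hΩ.isFiniteMeasure_frontier
  exact (integrable_const _).sub (hΩ.integrable_fluxKernel_prod hn ha).integral_prod_right

theorem IsRegularSet.integral_integral_yukawa (hΩ : IsRegularSet Ω) (hn : IsNormalField Ω n)
    (ha : 0 < a) :
    ∫ x in Ω, ∫ y in Ωᶜ, yukawa a (x - y) = 2 / a ^ 2 * (perimeter Ω).toReal -
      ∫ y in frontier Ω, fluxDefect Ω a (n y) y ∂(Measure.hausdorffMeasure 1) := by
  have := hΩ.isFiniteMeasure_frontier
  have hint := hΩ.integrable_fluxKernel_prod hn ha
  rw [setIntegral_congr_fun hΩ.isOpen.measurableSet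
    fun x hx => hΩ.integral_compl_yukawa hn ha hx, integral_integral_swap hint]
  have h := integral_sub (integrable_const (2 / a ^ 2)) (hΩ.integrable_fluxDefect hn ha)
  simp only [fluxDefect, sub_sub_cancel] at h ⊢
  rw [h, hΩ.perimeter_eq]
  simp [Measure.real, mul_comm]

/-- The uniform parabola constant bounds the rescaled defects by one number for all `y` and `a`,
which is integrable on a boundary of finite length. -/
theorem IsRegularSet.tendsto_integral_fluxDefect (hΩ : IsRegularSet Ω) (hn : IsNormalField Ω n) :
    Tendsto (fun a => a ^ 4 * ∫ y in frontier Ω, fluxDefect Ω a (n y) y ∂(Measure.hausdorffMeasure 1))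
      atTop (𝓝 ((∫ y in frontier Ω, curvature Ω y ^ 2 ∂(Measure.hausdorffMeasure 1)) / 2)) := by
  have := hΩ.isFiniteMeasure_frontier
  obtain ⟨C, hC, ht⟩ := hΩ.exists_uniform_isParabolicTangent hn
  have hm := (isClosed_frontier (s := Ω)).measurableSet
  simp only [← integral_const_mul]
  rw [← integral_div]
  refine tendsto_integral_filter_of_dominated_convergence (fun _ => ∫ p : ℝ × ℝ,
    C * (3 + 744 * C ^ 2) * ((1 + p.1 ^ 2)⁻¹ * (1 + p.2 ^ 2)⁻¹)) ?_ ?_ (integrable_const _) ?_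
  · filter_upwards [eventually_gt_atTop 0] with a ha
    exact ((hΩ.integrable_fluxDefect hn ha).const_mul _).aestronglyMeasurable
  · filter_upwards [eventually_gt_atTop 0] with a ha
    refine (ae_restrict_iff' hm).2 (Eventually.of_forall fun y hy => ?_)
    exact abs_pow_four_mul_fluxDefect_le hΩ.isOpen (hn.norm_eq_one hΩ hy) hC (ht y hy) ha
  · refine (ae_restrict_iff' hm).2 (Eventually.of_forall fun y hy => ?_)
    obtain ⟨r, e, f, hr, h⟩ := hΩ.exists_isGraphChart hy
    rw [hn.eq_chartNormal y hy _ e f h (Metric.mem_ball_self hr)]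
    exact tendsto_pow_four_mul_fluxDefect h hΩ.isOpen (Metric.mem_ball_self hr) hy

end Energy

theorem proposition2p5 (α : ℝ) (hα : 0 < α) (Ω : Set Plane) (hΩ : IsRegularSet Ω) :
    perimeter Ω ≠ ⊤ ∧
    (∀ l : ℝ, 0 < l → Integrable (fun p : Plane × Plane => yukawa (l * α) (p.1 - p.2))
      ((volume.restrict Ω).prod (volume.restrict Ωᶜ))) ∧
    IntegrableOn (fun x => curvature Ω x ^ 2) (frontier Ω) (Measure.hausdorffMeasure 1) ∧
    (fun l : ℝ => energy l α Ω -
        ((1 - 1 / (2 * Real.pi * α ^ 2)) * (perimeter Ω).toReal +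
          1 / (8 * Real.pi * α ^ 4 * l ^ 2) *
            ∫ x in frontier Ω, curvature Ω x ^ 2 ∂(Measure.hausdorffMeasure 1)))
      =o[atTop] (fun l : ℝ => (l ^ 2)⁻¹) := by
  refine ⟨?_, fun l hl => hΩ.integrable_yukawa_prod (by positivity), hΩ.integrableOn_curvature_sq, ?_⟩
  · rw [hΩ.perimeter_eq]; exact hΩ.hausdorffMeasure_frontier_lt_top.ne
  obtain ⟨n, hn⟩ := hΩ.exists_isNormalField
  set κ := ∫ x in frontier Ω, curvature Ω x ^ 2 ∂(Measure.hausdorffMeasure 1)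
  set D : ℝ → ℝ := fun a =>
    ∫ y in frontier Ω, fluxDefect Ω a (n y) y ∂(Measure.hausdorffMeasure 1)
  have hscale : Tendsto (fun l : ℝ => l * α) atTop atTop := tendsto_id.atTop_mul_const hα
  -- The error in the expansion is exactly `l⁻²` times this quantity, because `l²/(4π) · D(lα) = l⁻²
  -- (lα)⁴ D(lα) / (4πα⁴)`.
  have hlim : Tendsto (fun l : ℝ => 1 / (4 * Real.pi * α ^ 4) * ((l * α) ^ 4 * D (l * α) - κ / 2))
      atTop (𝓝 0) := by
    have h1 := ((hΩ.tendsto_integral_fluxDefect hn).comp hscale).sub_const (κ / 2)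
    rw [sub_self] at h1
    have h2 := h1.const_mul (1 / (4 * Real.pi * α ^ 4))
    rwa [mul_zero] at h2
  have ho := ((isLittleO_one_iff ℝ).2 hlim).mul_isBigO
    (isBigO_refl (fun l : ℝ => (l ^ 2)⁻¹) atTop)
  refine ho.congr' ?_ (by simp)
  filter_upwards [eventually_gt_atTop 0] with l hl
  have hJ := hΩ.integral_integral_yukawa hn (a := l * α) (by positivity)
  change _ = _ - D (l * α) at hJ
  rw [energy, hJ]
  have hpi := Real.pi_pos
  field_simp
  ring
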